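/- **Setting.** Let $K$ be the number of arms and $\Theta\subset\mathbb{R}^p$ open. For $\theta\in\Theta$ the rewards of arm $k$ are i.i.d. with a strictly positive density $f_k(\cdot\,|\,\theta)$ with respect to a common $\sigma$-finite measure $\nu$ on $\mathbb{R}$. At times $t=1,2,\dots$ an agent draws an arm $A_t$ from probabilities $\pi_t$ that depend only on the past $(A_s,Y_s)_{s<t}$ and not on $\theta$, and then observes a reward $Y_t$ drawn from arm $A_t$. Let $D_{k,T}=\sum_{t\le T}1\{A_t=k\}$. Fix $\theta\in\Theta$ and assume: (1) For each $k$ there is a measurable score $\dot\ell_k:\mathbb{R}\to\mathbb{R}^p$ with $E_\theta|\dot\ell_k(Z_k)|^2\in(0,\infty)$ such that $\sqrt{f_k(Z_k|\theta+\omega)}/\sqrt{f_k(Z_k|\theta)}=1+\tfrac12(\dot\ell_k(Z_k)'\omega+r_k(Z_k|\omega))$ with $E_\theta[r_k^2(Z_k|\omega)]=o(|\omega|^2)$ as $\omega\to0$. Put $J_k=E_\theta[\dot\ell_k(Z_k)\dot\ell_k(Z_k)']$. (2) The means $E_\theta[Z_k]$ exist, and there is a unique optimal arm $k^*$: $E_\theta[Z_{k^*}]>E_\theta[Z_k]$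 for all $k\ne k^*$. (3) Either (b) $D_{k,T}/\log T\to C_k\in(0,\infty)$ a.s. for every $k\ne k^*$, in which case put $C_{k^*}=1$ and $s_T=\log T$; or (b*) $D_{k,T}/T\to C_k\in(0,1)$ a.s. for every $k$, in which case put $s_T=T$. (Almost surely under the parameter $\theta$.) (4) In case (b): whenever the $j$-th component of $\dot\ell_{k^*}(Z_{k^*})$ vanishes a.s. under $\theta$, the density of arm $k^*$ does not depend on the $j$-th parameter component near $\theta$; that is, there is a neighbourhood $U$ of $\theta$ such that $f_{k^*}(\cdot|\theta_1)=f_{k^*}(\cdot|\theta_2)$ $\nu$-a.e. for all $\theta_1,\theta_2\in U$ that differ at most in their $j$-th component. **Notation.** Let $a_{k^*,T}=\sqrt T$ and $a_{k,T}=\sqrt{s_T}$ for $k\neq k^*$; let $R_T$ be the diagonal matrix with entries $r_{j,T}=\sqrt T$ if $J_{k^*}[j,j]>0$ and $r_{j,T}=\sqrt{s_T}$ otherwise. For $h\in\mathbb{R}^p$ let $P^{(T)}_{h}$ be the law of $(A_1,Y_1,\dots,A_T,Y_T)$ under the parameter $\theta+R_T^{-1}h$ (which lies in $\Theta$ for $T$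 large). Put $$S_{k,T}=\frac1{a_{k,T}}\sum_{t=1}^T1\{A_t=k\}\dot\ell_k(Y_t),\qquad J_{k,T}=\frac1{a_{k,T}^2}\sum_{t=1}^T1\{A_t=k\}J_k .$$ In case (b*) let $\Delta_T=\sum_kS_{k,T}$ and $\mathcal J=\sum_kC_kJ_k$. In case (b) let $$\Delta_T[j]=S_{k^*,T}[j]+1\{J_{k^*}[j,j]=0\}\sum_{k\ne k^*}S_{k,T}[j],$$ $$\mathcal J[l,m]=J_{k^*}[l,m]+1\{J_{k^*}[l,l]=J_{k^*}[m,m]=0\}\sum_{k\ne k^*}C_kJ_k[l,m].$$ **Conclusion.** As $T\to\infty$, under $P^{(T)}_{0}$: - $J_{k,T}\to C_kJ_k$ in probability, for every $k$; - the stacked vector $(S_{1,T}',\dots,S_{K,T}')'$ converges in distribution to $\mathcal N(0,\mathrm{diag}(C_1J_1,\dots,C_KJ_K))$, with block-diagonal covariance; - for every $h\in\mathbb{R}^p$, $\displaystyle\log\frac{dP^{(T)}_{h}}{dP^{(T)}_{0}}=h'\Delta_T-\tfrac12h'\mathcal Jh+o_P(1)$; - $\Delta_T$ converges in distribution to $\mathcal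 N(0,\mathcal J)$, so that the bandit experiment is locally asymptotically normal at $\theta$. -/

import Mathlib

open MeasureTheory ProbabilityTheory Filter Topology Asymptotics

namespace Bandit

noncomputable section

/-- The parameter space `ℝ^p` with the Euclidean norm. -/
abbrev Param (p : ℕ) := EuclideanSpace ℝ (Fin p)

/-- A parametric family of reward distributions for `K` arms, with strictly positive densities
`f k θ` (arm `k`, parameter `θ`) with respect to a common `σ`-finite measure `ν` on `ℝ`, indexed
by an open parameter set `Θ ⊆ ℝ^p`. -/
structure ArmModel (K p : ℕ) where
  Θ : Set (Param p)
  isOpen_Θ : IsOpen Θ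
  ν : Measure ℝ
  sigmaFinite_ν : SigmaFinite ν
  f : Fin K → Param p → ℝ → ℝ
  measurable_f : ∀ k, ∀ θ ∈ Θ, Measurable (f k θ)
  f_pos : ∀ k, ∀ θ ∈ Θ, ∀ z, 0 < f k θ z
  lintegral_f : ∀ k, ∀ θ ∈ Θ, ∫⁻ z, ENNReal.ofReal (f k θ z) ∂ν = 1

/-- A sampling policy for `K` arms: the distribution of the first action and, for every `n`, the
conditional distribution of the next action given the first `n + 1` action-reward pairs (those at
times `0, …, n`). A policy involves no parameter of the reward distributions. -/
structure Policy (K : ℕ) where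
  first : Measure (Fin K)
  isProbabilityMeasure_first : IsProbabilityMeasure first
  next : (n : ℕ) → Kernel ((i : Finset.Iic n) → Fin K × ℝ) (Fin K)
  isMarkovKernel_next : ∀ n, IsMarkovKernel (next n)

/-- The two sampling regimes: suboptimal arms are pulled at rate `log T`, or all arms are pulled
at rate `T`. -/
inductive Regime
  | logarithmic
  | linear

instance {K : ℕ} (pol : Policy K) : IsProbabilityMeasure pol.first :=
  pol.isProbabilityMeasure_first

instance {K : ℕ} (pol : Policy K) (n : ℕ) : IsMarkovKernel (pol.next n) :=
  pol.isMarkovKernel_next n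

/-- The effective sample size `s_T` of the suboptimal arms. -/
def Regime.size : Regime → ℕ → ℝ
  | .logarithmic, T => Real.log T
  | .linear, T => T

variable {K p : ℕ}

/-- The normalization `a_{k,T}`, when `ks` is the optimal arm. -/
def armRate (ks : Fin K) (reg : Regime) (k : Fin K) (T : ℕ) : ℝ :=
  if k = ks then Real.sqrt T else Real.sqrt (reg.size T)

/-- The number of pulls of arm `k` in a history of length `T`. -/
def pulls {T : ℕ} (k : Fin K) (x : Fin T → Fin K × ℝ) : ℕ :=
  (Finset.univ.filter fun t => (x t).1 = k).card

/-- The first `T` action-reward pairs of an infinite history. -/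
def truncate (T : ℕ) (ω : ℕ → Fin K × ℝ) : Fin T → Fin K × ℝ := fun t => ω t

lemma measurable_truncate (T : ℕ) : Measurable (truncate (K := K) T) :=
  measurable_pi_lambda _ fun _ => measurable_pi_apply _

/-- `X T` converges to the constant `c` in probability under `P T`, as `T → ∞`. -/
def TendstoInProbability {Ω : ℕ → Type*} [∀ T, MeasurableSpace (Ω T)]
    (P : (T : ℕ) → Measure (Ω T)) (X : (T : ℕ) → Ω T → ℝ) (c : ℝ) : Prop :=
  ∀ ε : ℝ, 0 < ε → Tendsto (fun T => P T {x | ε ≤ |X T x - c|}) atTop (𝓝 0)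

namespace ArmModel

variable (M : ArmModel K p)

open Classical in
/-- The reward distribution of arm `k` at `θ ∈ Θ`. For `θ ∉ Θ`, where the model says nothing, it
is set to a fixed probability measure so that it is defined for all `θ`. -/
def law (k : Fin K) (θ : Param p) : Measure ℝ :=
  if θ ∈ M.Θ then M.ν.withDensity (fun z => ENNReal.ofReal (M.f k θ z)) else Measure.dirac 0

instance (k : Fin K) (θ : Param p) : IsProbabilityMeasure (M.law k θ) := by
  unfold law
  split_ifs with h
  · exact ⟨by simpa using M.lintegral_f k θ h⟩
  · infer_instance

/-- The reward distribution as a function of the arm. -/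
def rewardKernel (θ : Param p) : Kernel (Fin K) ℝ where
  toFun k := M.law k θ
  measurable' := measurable_of_countable _

instance (θ : Param p) : IsMarkovKernel (M.rewardKernel θ) :=
  ⟨fun k => inferInstanceAs (IsProbabilityMeasure (M.law k θ))⟩

/-- Conditional distribution of the next action-reward pair given the history: the action is drawn
from the policy, and then the reward from the distribution of the chosen arm. -/
def step (pol : Policy K) (θ : Param p) (n : ℕ) :
    Kernel ((i : Finset.Iic n) → Fin K × ℝ) (Fin K × ℝ) :=
  pol.next n ⊗ₖ Kernel.prodMkLeft _ (M.rewardKernel θ)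

instance (pol : Policy K) (θ : Param p) (n : ℕ) : IsMarkovKernel (M.step pol θ n) := by
  unfold step
  infer_instance

/-- The law of the whole sequence `(A_1, Y_1), (A_2, Y_2), …` of actions and rewards under the
parameter `θ` (the pair with index `t + 1` is the coordinate `t`). -/
def pathLaw (pol : Policy K) (θ : Param p) : Measure (ℕ → Fin K × ℝ) :=
  Kernel.trajMeasure (X := fun _ => Fin K × ℝ) (pol.first ⊗ₘ M.rewardKernel θ) (M.step pol θ)

instance (pol : Policy K) (θ : Param p) : IsProbabilityMeasure (M.pathLaw pol θ) := by
  unfold pathLaw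
  infer_instance

/-- The law of `(A_1, Y_1, …, A_T, Y_T)` under the parameter `θ`. -/
def lawUpTo (pol : Policy K) (θ : Param p) (T : ℕ) : Measure (Fin T → Fin K × ℝ) :=
  (M.pathLaw pol θ).map (truncate T)

instance (pol : Policy K) (θ : Param p) (T : ℕ) : IsProbabilityMeasure (M.lawUpTo pol θ T) :=
  Measure.isProbabilityMeasure_map (measurable_truncate T).aemeasurable

/-- Differentiability in quadratic mean at `θ` of the densities of arm `k`, with score `ℓ`: with
`r z ω` defined by `√(f(z|θ+ω)) / √(f(z|θ)) = 1 + (ℓ(z)'ω + r z ω) / 2`, one has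
`E_θ[r(Z|ω)²] = o(|ω|²)` as `ω → 0`, and `E_θ|ℓ(Z)|² ∈ (0, ∞)`. -/
structure IsDQM (k : Fin K) (θ : Param p) (ℓ : ℝ → Param p) : Prop where
  measurable : Measurable ℓ
  memLp : MemLp ℓ 2 (M.law k θ)
  pos : 0 < ∫ z, ‖ℓ z‖ ^ 2 ∂(M.law k θ)
  remainder :
    (fun ω : Param p => ∫ z, (2 * (Real.sqrt (M.f k (θ + ω) z) / Real.sqrt (M.f k θ z) - 1)
        - inner ℝ (ℓ z) ω) ^ 2 ∂(M.law k θ))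
      =o[𝓝 0] fun ω => ‖ω‖ ^ 2

/-- Near `θ`, the distribution of arm `k` does not depend on the `j`-th parameter component. -/
def LocallyFreeOf (k : Fin K) (θ : Param p) (j : Fin p) : Prop :=
  ∃ U ∈ 𝓝 θ, ∀ θ₁ ∈ U, ∀ θ₂ ∈ U, (∀ i, i ≠ j → θ₁ i = θ₂ i) → M.f k θ₁ =ᵐ[M.ν] M.f k θ₂

/-- `ks` is the unique arm with the highest expected reward at `θ`. -/
def IsUniqueOptimalArm (θ : Param p) (ks : Fin K) : Prop :=
  (∀ k, Integrable (fun z => z) (M.law k θ)) ∧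
    ∀ k, k ≠ ks → ∫ z, z ∂(M.law k θ) < ∫ z, z ∂(M.law ks θ)

/-- The number of pulls of arm `k` up to time `T`, divided by `g T`, converges almost surely to
`c` under the parameter `θ`. -/
def PullRate (pol : Policy K) (θ : Param p) (k : Fin K) (g : ℕ → ℝ) (c : ℝ) : Prop :=
  ∀ᵐ ω ∂(M.pathLaw pol θ), Tendsto (fun T : ℕ => (pulls k (truncate T ω) : ℝ) / g T) atTop (𝓝 c)

/-- The assumption on the asymptotic number of pulls at `θ`. In the logarithmic regime it concerns
only the suboptimal arms, and `C ks = 1` is the convention for the optimal arm `ks`. -/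
def SamplingAssumption (pol : Policy K) (θ : Param p) (ks : Fin K) (C : Fin K → ℝ) :
    Regime → Prop
  | .logarithmic =>
      C ks = 1 ∧ ∀ k, k ≠ ks → 0 < C k ∧ M.PullRate pol θ k (fun T => Real.log T) (C k)
  | .linear => ∀ k, C k ∈ Set.Ioo (0 : ℝ) 1 ∧ M.PullRate pol θ k (fun T => (T : ℝ)) (C k)

/-- The Fisher information matrix `J_{θ,k} = E_θ[ℓ_k(Z_k) ℓ_k(Z_k)']` of arm `k`. -/
def fisher (θ : Param p) (ℓ : Fin K → ℝ → Param p) (k : Fin K) : Matrix (Fin p) (Fin p) ℝ :=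
  Matrix.of fun i j => ∫ z, ℓ k z i * ℓ k z j ∂(M.law k θ)

/-- The rate `r_{j,T}` for the `j`-th parameter component. -/
def paramRate (θ : Param p) (ℓ : Fin K → ℝ → Param p) (ks : Fin K) (reg : Regime) (T : ℕ)
    (j : Fin p) : ℝ :=
  if 0 < M.fisher θ ℓ ks j j then Real.sqrt T else Real.sqrt (reg.size T)

/-- The localized parameter `θ + R_T⁻¹ h`, where `R_T = diag(r_{1,T}, …, r_{p,T})`. -/
def localParam (θ : Param p) (ℓ : Fin K → ℝ → Param p) (ks : Fin K) (reg : Regime) (T : ℕ)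
    (h : Param p) : Param p :=
  θ + WithLp.toLp 2 fun j => (M.paramRate θ ℓ ks reg T j)⁻¹ * h j

/-- The normalized information `J_{k,T} = a_{k,T}⁻² ∑_{t ≤ T} 1{A_t = k} J_{θ,k}`. -/
def normalizedInfo (θ : Param p) (ℓ : Fin K → ℝ → Param p) (ks : Fin K) (reg : Regime)
    (k : Fin K) (T : ℕ) (x : Fin T → Fin K × ℝ) : Matrix (Fin p) (Fin p) ℝ :=
  (armRate ks reg k T ^ 2)⁻¹ • ∑ t, if (x t).1 = k then M.fisher θ ℓ k else 0

/-- The normalized score sum `S_{k,T} = a_{k,T}⁻¹ ∑_{t ≤ T} 1{A_t = k} ℓ_k(Y_t)`. -/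
def _root_.Bandit.scoreSum (ℓ : Fin K → ℝ → Param p) (ks : Fin K) (reg : Regime)
    (k : Fin K) (T : ℕ) (x : Fin T → Fin K × ℝ) : Param p :=
  (armRate ks reg k T)⁻¹ • ∑ t, if (x t).1 = k then ℓ k (x t).2 else 0

/-- The vectors `S_{1,T}, …, S_{K,T}` stacked into one vector of length `K p`, with entry `(j, k)`
equal to `S_{k,T}[j]`. -/
def _root_.Bandit.stackedScore (ℓ : Fin K → ℝ → Param p) (ks : Fin K) (reg : Regime)
    (T : ℕ) (x : Fin T → Fin K × ℝ) : EuclideanSpace ℝ (Fin p × Fin K) :=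
  WithLp.toLp 2 fun jk => scoreSum ℓ ks reg jk.2 T x jk.1

/-- The central sequence `Δ_T`. -/
def centralSeq (θ : Param p) (ℓ : Fin K → ℝ → Param p) (ks : Fin K) :
    Regime → (T : ℕ) → (Fin T → Fin K × ℝ) → Param p
  | .linear, T, x => WithLp.toLp 2 fun j => ∑ k, scoreSum ℓ ks .linear k T x j
  | .logarithmic, T, x => WithLp.toLp 2 fun j =>
      scoreSum ℓ ks .logarithmic ks T x j +
        if M.fisher θ ℓ ks j j = 0 then
          ∑ k ∈ Finset.univ.erase ks, scoreSum ℓ ks .logarithmic k T x j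
        else 0

/-- The Fisher information matrix of the limit experiment. -/
def limitInfo (θ : Param p) (ℓ : Fin K → ℝ → Param p) (ks : Fin K) (C : Fin K → ℝ) :
    Regime → Matrix (Fin p) (Fin p) ℝ
  | .linear => ∑ k, C k • M.fisher θ ℓ k
  | .logarithmic => Matrix.of fun l m =>
      M.fisher θ ℓ ks l m +
        if M.fisher θ ℓ ks l l = 0 ∧ M.fisher θ ℓ ks m m = 0 then
          ∑ k ∈ Finset.univ.erase ks, C k * M.fisher θ ℓ k l m
        else 0

end ArmModel

end

end Bandit

/-! Apart from the convergence of the information, which is the almost sure pull rates rewritten,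
everything rests on one limit theorem for sums ∑_{t ≤ T} g_{A_t}(Y_t) under adaptive sampling,
`tendsto_integral_exp_sum`. Put φ_k = E exp(i g_k(Z_k)). Let arm k count only for its first m_k
pulls and multiply the exponential of i times the sum by ∏ φ_k^(m_k - D_k), with the exponent cut
off at 0. The expectation is then ∏ φ_k^(m_k) for every policy, since a fresh reward contributes the
factor φ_k exactly when the exponent drops by one (`integral_compExp`). Suppose a_k²(φ_k - 1) → ψ_k
and D_k/a_k² → C_k a.s. With m_k ≈ (C_k + 1) a_k² the truncation eventually has no effect and the
compensator tends to the nonzero constant exp(∑ ψ_k). Dividing by it leaves exp(∑ C_k ψ_k). The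
exponent is a sum over arms, hence the block-diagonal covariance.

The ψ_k come from differentiability in quadratic mean. If w/2 is the increment of the root density
ratio, the log-likelihood ratio is 2 log(1 + w/2), a w → ℓ'v in L² when a ω → v, and the densities
integrating to one force E w = -E w²/4. A second order expansion of the characteristic function
(`tendsto_mul_integral_exp_sub_one`) gives ψ = -E(ℓ'v)²/2 for the score. For u times the error of
linearizing the log-likelihood it gives ψ = -iu E(ℓ'v)²/2, which belongs to a constant: this is the
quadratic term of the LAN expansion, attained in probability.

The direction v seen by arm k is the limit of a_k R_T⁻¹h, which is h with some components masked.
For the optimal arm in the logarithmic regime this limit may fail to exist, because components with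
vanishing score are perturbed at the larger scale 1/√(log T). The density is locally free of exactly
those components, so they can be set to zero. -/

open MeasureTheory ProbabilityTheory Filter Topology Asymptotics

namespace Bandit

noncomputable section

variable {K p : ℕ}

/-! ### One-step disintegration of the law of the history -/

/-- Histories of length `n + 1`, indexed by `Fin (n + 1)`, as functions on `Finset.Iic n`. -/
def toIic {α : Type*} (n : ℕ) (x : Fin (n + 1) → α) : (Finset.Iic n) → α :=
  fun i => x ⟨i, Nat.lt_succ_of_le (Finset.mem_Iic.mp i.2)⟩

lemma measurable_toIic {α : Type*} [MeasurableSpace α] (n : ℕ) : Measurable (toIic (α := α) n) :=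
  measurable_pi_lambda _ fun _ => measurable_pi_apply _

/-- The conditional distribution of the next action given a history of length `n`. -/
def Policy.action (pol : Policy K) : (n : ℕ) → Kernel (Fin n → Fin K × ℝ) (Fin K)
  | 0 => Kernel.const _ pol.first
  | n + 1 => (pol.next n).comap (toIic n) (measurable_toIic n)

instance (pol : Policy K) (n : ℕ) : IsMarkovKernel (pol.action n) := by
  cases n <;> unfold Policy.action <;> infer_instance

/-- Append a pair to a history. -/
def append {α : Type*} (n : ℕ) (z : (Fin n → α) × α) : Fin (n + 1) → α :=
  Fin.snoc (α := fun _ => α) z.1 z.2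

lemma measurable_append {α : Type*} [MeasurableSpace α] (n : ℕ) :
    Measurable (append (α := α) n) := by
  refine measurable_pi_lambda _ fun i => ?_
  refine Fin.lastCases ?_ (fun j => ?_) i
  · simpa [append] using measurable_snd
  · simp only [append, Fin.snoc_castSucc]
    exact (measurable_pi_apply j).comp measurable_fst

namespace ArmModel

variable (M : ArmModel K p)

/-- The conditional distribution of the next action-reward pair given a history of length `n`. -/
def pairKernel (pol : Policy K) (θ : Param p) (n : ℕ) :
    Kernel (Fin n → Fin K × ℝ) (Fin K × ℝ) :=
  pol.action n ⊗ₖ Kernel.prodMkLeft _ (M.rewardKernel θ)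

instance (pol : Policy K) (θ : Param p) (n : ℕ) : IsMarkovKernel (M.pairKernel pol θ n) := by
  unfold pairKernel
  infer_instance

lemma pathLaw_map_eval_zero (pol : Policy K) (θ : Param p) :
    (M.pathLaw pol θ).map (fun ω => ω 0) = pol.first ⊗ₘ M.rewardKernel θ := by
  have h : (M.pathLaw pol θ).map (Preorder.frestrictLe 0) =
      (pol.first ⊗ₘ M.rewardKernel θ).map
        (MeasurableEquiv.piUnique fun _ : Finset.Iic 0 => Fin K × ℝ).symm := by
    rw [pathLaw, Kernel.trajMeasure, Measure.map_comp _ _ (by fun_prop),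
      Kernel.traj_map_frestrictLe, Kernel.partialTraj_self, Measure.id_comp]
  have h' := congrArg (Measure.map (MeasurableEquiv.piUnique fun _ : Finset.Iic 0 => Fin K × ℝ)) h
  rw [Measure.map_map (by fun_prop) (by fun_prop), Measure.map_map (by fun_prop) (by fun_prop),
    MeasurableEquiv.self_comp_symm, Measure.map_id] at h'
  exact h'

/-- Histories indexed by `Finset.Iic n` as functions on `Fin (n + 1)`. -/
def _root_.Bandit.ofIic {α : Type*} (n : ℕ) (x : Finset.Iic n → α) : Fin (n + 1) → α :=
  fun i => x ⟨i, Finset.mem_Iic.mpr (Nat.le_of_lt_succ i.2)⟩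

lemma _root_.Bandit.measurable_ofIic {α : Type*} [MeasurableSpace α] (n : ℕ) :
    Measurable (ofIic (α := α) n) :=
  measurable_pi_lambda _ fun _ => measurable_pi_apply _

lemma pairKernel_succ_ofIic (pol : Policy K) (θ : Param p) (n : ℕ)
    (x : Finset.Iic n → Fin K × ℝ) :
    M.pairKernel pol θ (n + 1) (ofIic n x) = M.step pol θ n x := by
  refine Measure.ext_of_lintegral _ fun F hF => ?_
  rw [pairKernel, step, Kernel.lintegral_compProd _ _ _ hF, Kernel.lintegral_compProd _ _ _ hF]
  rfl

/-- The trajectory measure starts from the first pair, while the recursion used below starts from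
the empty history. Hence the case split: the initial law at time 0, and the Markov property of the
trajectory measure afterwards. -/
lemma pathLaw_map_truncate_prodMk (pol : Policy K) (θ : Param p) (n : ℕ) :
    (M.pathLaw pol θ).map (fun ω => (truncate n ω, ω n)) =
      M.lawUpTo pol θ n ⊗ₘ M.pairKernel pol θ n := by
  refine Measure.ext_of_lintegral _ fun F hF => ?_
  rw [lintegral_map hF ((measurable_truncate n).prodMk (measurable_pi_apply n)),
    Measure.lintegral_compProd hF, lawUpTo,
    lintegral_map hF.lintegral_kernel_prod_right' (measurable_truncate n)]
  cases n with
  | zero =>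
    have e : ∀ ω : ℕ → Fin K × ℝ, truncate 0 ω = Fin.elim0 := fun ω => Subsingleton.elim _ _
    have hF0 : Measurable fun z => F (Fin.elim0, z) := hF.comp measurable_prodMk_left
    simp_rw [e]
    rw [lintegral_const, measure_univ, mul_one,
      ← lintegral_map (f := fun z => F (Fin.elim0, z)) hF0 (measurable_pi_apply 0),
      pathLaw_map_eval_zero, pairKernel, Kernel.lintegral_compProd _ _ _ hF0,
      Measure.lintegral_compProd hF0]
    rfl
  | succ n =>
    have h : (M.pathLaw pol θ).map (Preorder.frestrictLe n) ⊗ₘ M.step pol θ n =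
        (M.pathLaw pol θ).map (fun x => (Preorder.frestrictLe n x, x (n + 1))) :=
      Kernel.map_frestrictLe_trajMeasure_compProd_eq_map_trajMeasure
    have hG : Measurable fun z : (Finset.Iic n → Fin K × ℝ) × (Fin K × ℝ) =>
        F (ofIic n z.1, z.2) :=
      hF.comp (((measurable_ofIic n).comp measurable_fst).prodMk measurable_snd)
    have h' := congrArg (fun μ => ∫⁻ z, F (ofIic n z.1, z.2) ∂μ) h
    rw [Measure.lintegral_compProd hG, lintegral_map hG (by fun_prop),
      lintegral_map hG.lintegral_kernel_prod_right' (by fun_prop)] at h'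
    refine h'.symm.trans (lintegral_congr fun ω => ?_)
    rw [← pairKernel_succ_ofIic]
    rfl

lemma lawUpTo_succ (pol : Policy K) (θ : Param p) (n : ℕ) :
    M.lawUpTo pol θ (n + 1) =
      (M.lawUpTo pol θ n ⊗ₘ M.pairKernel pol θ n).map (append n) := by
  rw [← pathLaw_map_truncate_prodMk, Measure.map_map (measurable_append n)
    ((measurable_truncate n).prodMk (measurable_pi_apply n)), lawUpTo]
  congr 1
  ext ω : 1
  funext i
  refine Fin.lastCases ?_ (fun j => ?_) i <;> simp [append, truncate]

lemma lintegral_pairKernel (pol : Policy K) (θ : Param p) (n : ℕ) (x : Fin n → Fin K × ℝ)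
    {F : Fin K × ℝ → ENNReal} (hF : Measurable F) :
    ∫⁻ z, F z ∂(M.pairKernel pol θ n x) =
      ∫⁻ a, ∫⁻ y, F (a, y) ∂(M.law a θ) ∂(pol.action n x) := by
  rw [pairKernel, Kernel.lintegral_compProd _ _ _ hF]
  rfl

lemma lintegral_lawUpTo_succ (pol : Policy K) (θ : Param p) (n : ℕ)
    {F : (Fin (n + 1) → Fin K × ℝ) → ENNReal} (hF : Measurable F) :
    ∫⁻ x, F x ∂(M.lawUpTo pol θ (n + 1)) =
      ∫⁻ x, ∫⁻ a, ∫⁻ y, F (append n (x, (a, y))) ∂(M.law a θ) ∂(pol.action n x)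
        ∂(M.lawUpTo pol θ n) := by
  have hF' := hF.comp (measurable_append (α := Fin K × ℝ) n)
  rw [lawUpTo_succ, lintegral_map hF (measurable_append n)]
  refine (Measure.lintegral_compProd hF').trans ?_
  refine lintegral_congr fun x => ?_
  exact M.lintegral_pairKernel pol θ n x (F := fun z => F (append n (x, z)))
    (hF'.comp measurable_prodMk_left)

lemma integral_lawUpTo_succ (pol : Policy K) (θ : Param p) (n : ℕ)
    {F : (Fin (n + 1) → Fin K × ℝ) → ℂ} (hF : Measurable F) {B : ℝ} (hB : ∀ x, ‖F x‖ ≤ B) :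
    ∫ x, F x ∂(M.lawUpTo pol θ (n + 1)) =
      ∫ x, ∫ a, ∫ y, F (append n (x, (a, y))) ∂(M.law a θ) ∂(pol.action n x)
        ∂(M.lawUpTo pol θ n) := by
  have hF' := hF.comp (measurable_append (α := Fin K × ℝ) n)
  rw [lawUpTo_succ, integral_map (measurable_append n).aemeasurable hF.aestronglyMeasurable,
    Measure.integral_compProd]
  · refine integral_congr_ae (ae_of_all _ fun x => ?_)
    simp only
    rw [pairKernel, ProbabilityTheory.integral_compProd]
    · rfl
    · exact Integrable.of_bound (C := B)
        (hF'.comp measurable_prodMk_left).aestronglyMeasurable (ae_of_all _ fun _ => hB _)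
  · exact Integrable.of_bound (C := B) hF'.aestronglyMeasurable (ae_of_all _ fun _ => hB _)

/-! ### Likelihood ratios of histories -/

lemma law_of_mem {θ : Param p} (hθ : θ ∈ M.Θ) (k : Fin K) :
    M.law k θ = M.ν.withDensity (fun z => ENNReal.ofReal (M.f k θ z)) := by
  simp [law, hθ]

lemma law_eq_withDensity {θ θ' : Param p} (hθ : θ ∈ M.Θ) (hθ' : θ' ∈ M.Θ) (k : Fin K) :
    M.law k θ' =
      (M.law k θ).withDensity (fun z => ENNReal.ofReal (M.f k θ' z / M.f k θ z)) := by
  have h := M.measurable_f k θ hθ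
  have h' := M.measurable_f k θ' hθ'
  rw [M.law_of_mem hθ, M.law_of_mem hθ', ← withDensity_mul _ (by fun_prop) (by fun_prop)]
  congr 1
  ext z
  rw [Pi.mul_apply, ← ENNReal.ofReal_mul (M.f_pos k θ hθ z).le,
    mul_div_cancel₀ _ (M.f_pos k θ hθ z).ne']

/-- The likelihood ratio of `θ'` with respect to `θ` after `T` observations. -/
def likelihoodRatio (θ θ' : Param p) (T : ℕ) (x : Fin T → Fin K × ℝ) : ℝ :=
  ∏ t, M.f (x t).1 θ' (x t).2 / M.f (x t).1 θ (x t).2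

lemma measurable_pair {g : Fin K → ℝ → ℝ} (hg : ∀ k, Measurable (g k)) :
    Measurable fun z : Fin K × ℝ => g z.1 z.2 :=
  measurable_from_prod_countable_right hg

lemma measurable_likelihoodRatio {θ θ' : Param p} (hθ : θ ∈ M.Θ) (hθ' : θ' ∈ M.Θ) (T : ℕ) :
    Measurable (M.likelihoodRatio θ θ' T) := by
  refine Finset.measurable_fun_prod _ fun t _ => ?_
  exact (measurable_pair (g := fun k y => M.f k θ' y / M.f k θ y)
    fun k => (M.measurable_f k θ' hθ').div (M.measurable_f k θ hθ)).comp (measurable_pi_apply t)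

lemma likelihoodRatio_append (θ θ' : Param p) (n : ℕ) (x : Fin n → Fin K × ℝ) (z : Fin K × ℝ) :
    M.likelihoodRatio θ θ' (n + 1) (append n (x, z)) =
      M.likelihoodRatio θ θ' n x * (M.f z.1 θ' z.2 / M.f z.1 θ z.2) := by
  simp only [likelihoodRatio, append, Fin.prod_univ_castSucc, Fin.snoc_castSucc, Fin.snoc_last]

lemma likelihoodRatio_pos {θ θ' : Param p} (hθ : θ ∈ M.Θ) (hθ' : θ' ∈ M.Θ) (T : ℕ)
    (x : Fin T → Fin K × ℝ) : 0 < M.likelihoodRatio θ θ' T x :=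
  Finset.prod_pos fun _ _ => div_pos (M.f_pos _ _ hθ' _) (M.f_pos _ _ hθ _)

/-- The action kernels are the same under both parameters, so at each step only the reward law is
reweighted and the policy cancels. -/
lemma lintegral_lawUpTo_eq {θ θ' : Param p} (hθ : θ ∈ M.Θ) (hθ' : θ' ∈ M.Θ) (pol : Policy K)
    (T : ℕ) : ∀ {F : (Fin T → Fin K × ℝ) → ENNReal}, Measurable F →
      ∫⁻ x, F x ∂(M.lawUpTo pol θ' T) =
        ∫⁻ x, ENNReal.ofReal (M.likelihoodRatio θ θ' T x) * F x ∂(M.lawUpTo pol θ T) := by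
  induction T with
  | zero =>
    intro F hF
    have : ∀ x : Fin 0 → Fin K × ℝ, F x = F Fin.elim0 := fun x => congrArg F (Subsingleton.elim _ _)
    simp [this, likelihoodRatio]
  | succ n ih =>
    intro F hF
    have hL := M.measurable_likelihoodRatio hθ hθ'
    have hF' := hF.comp (measurable_append (α := Fin K × ℝ) n)
    rw [M.lintegral_lawUpTo_succ _ _ _ hF, M.lintegral_lawUpTo_succ _ _ _
      (F := fun x => ENNReal.ofReal (M.likelihoodRatio θ θ' (n + 1) x) * F x)
      ((hL _).ennreal_ofReal.mul hF)]
    have key : Measurable fun x => ∫⁻ a, ∫⁻ y, F (append n (x, (a, y))) ∂(M.law a θ')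
        ∂(pol.action n x) := by
      have : ∀ x, ∫⁻ a, ∫⁻ y, F (append n (x, (a, y))) ∂(M.law a θ') ∂(pol.action n x) =
          ∫⁻ z, F (append n (x, z)) ∂(M.pairKernel pol θ' n x) := fun x =>
        (M.lintegral_pairKernel pol θ' n x (F := fun z => F (append n (x, z)))
          (hF'.comp measurable_prodMk_left)).symm
      simp_rw [this]
      exact hF'.lintegral_kernel_prod_right'
    rw [ih key]
    refine lintegral_congr fun x => ?_
    rw [← lintegral_const_mul _ (measurable_of_countable _)]
    refine lintegral_congr fun a => ?_
    have hy : Measurable fun y => F (append n (x, (a, y))) :=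
      hF'.comp (measurable_prodMk_left.comp measurable_prodMk_left)
    have hr : Measurable fun y => ENNReal.ofReal (M.f a θ' y / M.f a θ y) :=
      ((M.measurable_f a θ' hθ').div (M.measurable_f a θ hθ)).ennreal_ofReal
    rw [M.law_eq_withDensity hθ hθ', lintegral_withDensity_eq_lintegral_mul _ hr hy,
      ← lintegral_const_mul _ (hr.mul hy)]
    refine lintegral_congr fun y => ?_
    rw [likelihoodRatio_append, ENNReal.ofReal_mul (M.likelihoodRatio_pos hθ hθ' n x).le,
      Pi.mul_apply, mul_assoc]

lemma lawUpTo_eq_withDensity {θ θ' : Param p} (hθ : θ ∈ M.Θ) (hθ' : θ' ∈ M.Θ) (pol : Policy K)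
    (T : ℕ) : M.lawUpTo pol θ' T = (M.lawUpTo pol θ T).withDensity
      (fun x => ENNReal.ofReal (M.likelihoodRatio θ θ' T x)) := by
  refine Measure.ext_of_lintegral _ fun F hF => ?_
  rw [M.lintegral_lawUpTo_eq hθ hθ' pol T hF, lintegral_withDensity_eq_lintegral_mul _
    (M.measurable_likelihoodRatio hθ hθ' T).ennreal_ofReal hF]
  rfl

lemma llr_lawUpTo {θ θ' : Param p} (hθ : θ ∈ M.Θ) (hθ' : θ' ∈ M.Θ) (pol : Policy K) (T : ℕ) :
    llr (M.lawUpTo pol θ' T) (M.lawUpTo pol θ T) =ᵐ[M.lawUpTo pol θ T]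
      fun x => ∑ t, Real.log (M.f (x t).1 θ' (x t).2 / M.f (x t).1 θ (x t).2) := by
  have h := Measure.rnDeriv_withDensity (M.lawUpTo pol θ T)
    (M.measurable_likelihoodRatio hθ hθ' T).ennreal_ofReal
  rw [← M.lawUpTo_eq_withDensity hθ hθ' pol T] at h
  filter_upwards [h] with x hx
  rw [llr, hx, ENNReal.toReal_ofReal (M.likelihoodRatio_pos hθ hθ' T x).le, likelihoodRatio,
    Real.log_prod]
  exact fun t _ => (div_pos (M.f_pos _ _ hθ' _) (M.f_pos _ _ hθ _)).ne'

end ArmModel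

/-! ### A limit theorem for sums over adaptively sampled arms -/

/-- Since φ → 1, the principal logarithm satisfies log φ = (φ - 1) + o(φ - 1), so A log φ → ψ and
φ^n = exp((n/A) · A log φ). -/
lemma tendsto_pow_exp_of_tendsto_mul_sub_one {ι : Type*} {l : Filter ι} {A : ι → ℝ} {φ : ι → ℂ}
    {n : ι → ℕ} {ψ : ℂ} {x : ℝ} (hA : Tendsto A l atTop)
    (hφ : Tendsto (fun i => (A i : ℂ) * (φ i - 1)) l (𝓝 ψ))
    (hn : Tendsto (fun i => (n i : ℝ) / A i) l (𝓝 x)) :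
    Tendsto (fun i => φ i ^ n i) l (𝓝 (Complex.exp (x * ψ))) := by
  have hA0 : ∀ᶠ i in l, A i ≠ 0 := hA.eventually_ne_atTop 0
  have hinv : Tendsto (fun i => ((A i)⁻¹ : ℂ)) l (𝓝 0) := by
    have := (Complex.continuous_ofReal.tendsto 0).comp (tendsto_inv_atTop_zero.comp hA)
    simpa [Function.comp_def] using this
  have h1 : Tendsto φ l (𝓝 1) := by
    have h := (hinv.mul hφ).add_const 1
    rw [zero_mul, zero_add] at h
    refine h.congr' ?_
    filter_upwards [hA0] with i hi
    have : (A i : ℂ) ≠ 0 := by exact_mod_cast hi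
    field_simp
    ring
  have hlog : (fun z : ℂ => Complex.log z - (z - 1)) =o[𝓝 1] fun z => z - 1 := by
    have := (Complex.hasDerivAt_log (z := 1) Complex.one_mem_slitPlane).isLittleO
    simpa using this
  have h2 : Tendsto (fun i => (A i : ℂ) * (Complex.log (φ i) - (φ i - 1))) l (𝓝 0) := by
    have h := (isBigO_refl (fun i => (A i : ℂ)) l).mul_isLittleO (hlog.comp_tendsto h1)
    exact (isLittleO_one_iff ℂ).mp (h.trans_isBigO (hφ.isBigO_one ℂ))
  have h3 : Tendsto (fun i => (A i : ℂ) * Complex.log (φ i)) l (𝓝 ψ) := by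
    have := h2.add hφ
    rw [zero_add] at this
    exact this.congr fun i => by ring
  have h4 : Tendsto (fun i => (((n i : ℝ) / A i : ℝ) : ℂ) * ((A i : ℂ) * Complex.log (φ i))) l
      (𝓝 (x * ψ)) := ((Complex.continuous_ofReal.tendsto x).comp hn).mul h3
  refine ((Complex.continuous_exp.tendsto _).comp h4).congr' ?_
  filter_upwards [hA0, h1.eventually_ne one_ne_zero] with i hi hφi
  have : (A i : ℂ) ≠ 0 := by exact_mod_cast hi
  simp only [Function.comp_apply]
  rw [show (((n i : ℝ) / A i : ℝ) : ℂ) * ((A i : ℂ) * Complex.log (φ i)) =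
    n i * Complex.log (φ i) by push_cast; field_simp, Complex.exp_nat_mul, Complex.exp_log hφi]

lemma pulls_eq_sum {T : ℕ} (k : Fin K) (x : Fin T → Fin K × ℝ) :
    pulls k x = ∑ t, if (x t).1 = k then 1 else 0 := by
  rw [pulls, Finset.card_filter]

lemma pulls_append {n : ℕ} (k : Fin K) (x : Fin n → Fin K × ℝ) (a : Fin K) (y : ℝ) :
    pulls k (append n (x, (a, y))) = pulls k x + if a = k then 1 else 0 := by
  simp only [pulls_eq_sum, append, Fin.sum_univ_castSucc, Fin.snoc_castSucc, Fin.snoc_last]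

lemma measurable_pulls {T : ℕ} (k : Fin K) : Measurable (pulls (T := T) k) := by
  have : pulls (T := T) k = fun x => ∑ t, if (x t).1 = k then 1 else 0 :=
    funext fun x => pulls_eq_sum k x
  rw [this]
  refine Finset.measurable_fun_sum _ fun t _ => ?_
  exact (measurable_of_countable (fun a : Fin K => if a = k then 1 else 0)).comp
    (measurable_fst.comp (measurable_pi_apply t))

lemma append_init_last {α : Type*} (n : ℕ) (x : Fin (n + 1) → α) :
    append n (Fin.init x, x (Fin.last n)) = x :=
  Fin.snoc_init_self x

/-- The exponential of the sum of `g` over the rewards, where arm `k` only counts for its first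
`m k` pulls. -/
def truncExp (g : Fin K → ℝ → ℝ) (m : Fin K → ℕ) : (n : ℕ) → (Fin n → Fin K × ℝ) → ℂ
  | 0, _ => 1
  | n + 1, x => truncExp g m n (Fin.init x) *
      if pulls (x (Fin.last n)).1 (Fin.init x) < m (x (Fin.last n)).1 then
        Complex.exp (g (x (Fin.last n)).1 (x (Fin.last n)).2 * Complex.I) else 1

lemma truncExp_append (g : Fin K → ℝ → ℝ) (m : Fin K → ℕ) (n : ℕ) (x : Fin n → Fin K × ℝ)
    (a : Fin K) (y : ℝ) : truncExp g m (n + 1) (append n (x, (a, y))) =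
      truncExp g m n x * if pulls a x < m a then Complex.exp (g a y * Complex.I) else 1 := by
  simp [truncExp, append, Fin.init_snoc]

lemma norm_truncExp (g : Fin K → ℝ → ℝ) (m : Fin K → ℕ) (n : ℕ) (x : Fin n → Fin K × ℝ) :
    ‖truncExp g m n x‖ = 1 := by
  induction n with
  | zero => simp [truncExp]
  | succ n ih =>
    rw [truncExp, norm_mul, ih, one_mul]
    split_ifs
    · exact Complex.norm_exp_ofReal_mul_I _
    · exact norm_one

lemma measurable_truncExp {g : Fin K → ℝ → ℝ} (hg : ∀ k, Measurable (g k)) (m : Fin K → ℕ)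
    (n : ℕ) : Measurable (truncExp g m n) := by
  induction n with
  | zero => exact measurable_const
  | succ n ih =>
    have hinit : Measurable fun x : Fin (n + 1) → Fin K × ℝ => Fin.init x :=
      measurable_pi_lambda _ fun i => measurable_pi_apply i.castSucc
    have hlast : Measurable fun x : Fin (n + 1) → Fin K × ℝ => x (Fin.last n) :=
      measurable_pi_apply _
    have hp : Measurable fun z : Fin K × (Fin n → Fin K × ℝ) => pulls z.1 z.2 :=
      measurable_from_prod_countable_right fun k => measurable_pulls k
    refine (ih.comp hinit).mul (Measurable.ite (measurableSet_lt ?_ ?_) ?_ measurable_const)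
    · exact hp.comp ((measurable_fst.comp hlast).prodMk hinit)
    · exact (measurable_of_countable m).comp (measurable_fst.comp hlast)
    · exact ((Complex.measurable_ofReal.comp
        ((ArmModel.measurable_pair hg).comp hlast)).mul_const _).cexp

lemma truncExp_of_pulls_le (g : Fin K → ℝ → ℝ) (m : Fin K → ℕ) (n : ℕ)
    (x : Fin n → Fin K × ℝ) (h : ∀ k, pulls k x ≤ m k) :
    truncExp g m n x = Complex.exp ((∑ t, g (x t).1 (x t).2 : ℝ) * Complex.I) := by
  induction n with
  | zero => simp [truncExp]
  | succ n ih =>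
    obtain ⟨y, a, r, rfl⟩ : ∃ y a r, x = append n (y, (a, r)) :=
      ⟨_, _, _, (append_init_last n x).symm⟩
    simp only [pulls_append] at h
    have hz := h a
    rw [if_pos rfl] at hz
    rw [truncExp_append, ih y fun k => (Nat.le_add_right _ _).trans (h k), if_pos (by omega),
      ← Complex.exp_add, ← add_mul, ← Complex.ofReal_add]
    simp [append, Fin.sum_univ_castSucc]

/-- The truncated exponential, compensated so that it becomes a martingale. -/
def compExp (g : Fin K → ℝ → ℝ) (m : Fin K → ℕ) (φ : Fin K → ℂ) (n : ℕ)
    (x : Fin n → Fin K × ℝ) : ℂ :=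
  truncExp g m n x * ∏ k, φ k ^ (m k - pulls k x)

lemma measurable_compExp {g : Fin K → ℝ → ℝ} (hg : ∀ k, Measurable (g k)) (m : Fin K → ℕ)
    (φ : Fin K → ℂ) (n : ℕ) : Measurable (compExp g m φ n) := by
  refine (measurable_truncExp hg m n).mul (Finset.measurable_fun_prod _ fun k _ => ?_)
  exact (measurable_of_countable fun j : ℕ => φ k ^ (m k - j)).comp (measurable_pulls k)

lemma norm_compExp_le (g : Fin K → ℝ → ℝ) (m : Fin K → ℕ) {φ : Fin K → ℂ}
    (hφ : ∀ k, ‖φ k‖ ≤ 1) (n : ℕ) (x : Fin n → Fin K × ℝ) : ‖compExp g m φ n x‖ ≤ 1 := by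
  rw [compExp, norm_mul, norm_truncExp, one_mul, norm_prod]
  refine Finset.prod_le_one (fun _ _ => norm_nonneg _) fun k _ => ?_
  rw [norm_pow]
  exact pow_le_one₀ (norm_nonneg _) (hφ k)

namespace ArmModel

variable (M : ArmModel K p)

/-- The martingale property. If the pull still counts, the new reward integrates to φ_a, which
restores the power of φ_a lost by the compensator. If it does not, natural subtraction keeps the
exponent at 0 and nothing changes. -/
lemma integral_compExp_append (θ : Param p) (g : Fin K → ℝ → ℝ) (m : Fin K → ℕ) {φ : Fin K → ℂ}
    (hφ : ∀ k, φ k = ∫ y, Complex.exp (g k y * Complex.I) ∂(M.law k θ)) (n : ℕ)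
    (x : Fin n → Fin K × ℝ) (a : Fin K) :
    ∫ y, compExp g m φ (n + 1) (append n (x, (a, y))) ∂(M.law a θ) = compExp g m φ n x := by
  simp only [compExp, truncExp_append, pulls_append]
  by_cases h : pulls a x < m a
  · simp only [h, if_true]
    rw [integral_mul_const, integral_const_mul, ← hφ, mul_assoc]
    congr 1
    -- Spread over all arms, the factor φ_a can be absorbed into the compensator arm by arm.
    have : φ a = ∏ k, if a = k then φ k else 1 := by simp
    rw [this, ← Finset.prod_mul_distrib]
    refine Finset.prod_congr rfl fun k _ => ?_
    by_cases hk : a = k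
    · subst hk
      simp only [if_true]
      rw [← pow_succ']
      congr 1
      omega
    · simp [hk]
  · simp only [h, if_false, mul_one]
    rw [integral_const, probReal_univ, one_smul]
    congr 1
    refine Finset.prod_congr rfl fun k _ => ?_
    by_cases hk : a = k
    · subst hk
      simp only [if_true]
      congr 1
      omega
    · simp [hk]

lemma integral_compExp (pol : Policy K) (θ : Param p) {g : Fin K → ℝ → ℝ}
    (hg : ∀ k, Measurable (g k)) (m : Fin K → ℕ) {φ : Fin K → ℂ}
    (hφ : ∀ k, φ k = ∫ y, Complex.exp (g k y * Complex.I) ∂(M.law k θ))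
    (hφ1 : ∀ k, ‖φ k‖ ≤ 1) (n : ℕ) :
    ∫ x, compExp g m φ n x ∂(M.lawUpTo pol θ n) = ∏ k, φ k ^ m k := by
  induction n with
  | zero => simp [compExp, truncExp, pulls]
  | succ n ih =>
    rw [M.integral_lawUpTo_succ pol θ n (measurable_compExp hg m φ _)
      (norm_compExp_le g m hφ1 _), ← ih]
    simp [M.integral_compExp_append θ g m hφ]

lemma integral_lawUpTo (pol : Policy K) (θ : Param p) (T : ℕ) {F : (Fin T → Fin K × ℝ) → ℂ}
    (hF : Measurable F) :
    ∫ x, F x ∂(M.lawUpTo pol θ T) = ∫ ω, F (truncate T ω) ∂(M.pathLaw pol θ) :=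
  integral_map (measurable_truncate T).aemeasurable hF.aestronglyMeasurable

lemma measurable_sum_apply {g : Fin K → ℝ → ℝ} (hg : ∀ k, Measurable (g k)) (T : ℕ) :
    Measurable fun x : Fin T → Fin K × ℝ => ∑ t, g (x t).1 (x t).2 :=
  Finset.measurable_fun_sum _ fun t _ => (measurable_pair hg).comp (measurable_pi_apply t)

/-- A central limit theorem in terms of characteristic functions for sums of rewards with
triangular transformations `g k T`, when the numbers of pulls stabilize. -/
theorem tendsto_integral_exp_sum (pol : Policy K) (θ : Param p) {A : Fin K → ℕ → ℝ}
    (hA : ∀ k, Tendsto (A k) atTop atTop) {C : Fin K → ℝ} (hC : ∀ k, 0 ≤ C k)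
    (hD : ∀ k, M.PullRate pol θ k (A k) (C k))
    {g : Fin K → ℕ → ℝ → ℝ} (hg : ∀ k, ∀ᶠ T in atTop, Measurable (g k T)) {ψ : Fin K → ℂ}
    (hψ : ∀ k, Tendsto (fun T => (A k T : ℂ) *
      ((∫ y, Complex.exp (g k T y * Complex.I) ∂(M.law k θ)) - 1)) atTop (𝓝 (ψ k))) :
    Tendsto (fun T => ∫ x, Complex.exp ((∑ t, g (x t).1 T (x t).2 : ℝ) * Complex.I)
      ∂(M.lawUpTo pol θ T)) atTop (𝓝 (Complex.exp (∑ k, C k * ψ k))) := by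
  set φ : ℕ → Fin K → ℂ := fun T k => ∫ y, Complex.exp (g k T y * Complex.I) ∂(M.law k θ) with hφ
  have hφ1 : ∀ T k, ‖φ T k‖ ≤ 1 := fun T k => by
    refine (norm_integral_le_of_norm_le_const (C := 1) (ae_of_all _ fun y => ?_)).trans (by simp)
    rw [Complex.norm_exp_ofReal_mul_I]
  -- The margin 1 over C_k makes D_k ≤ m_k hold eventually on almost every path, and (m_k - D_k)/A_k
  -- tends to 1 whatever C_k is.
  set m : ℕ → Fin K → ℕ := fun T k => ⌈(C k + 1) * A k T⌉₊ with hm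
  have hmA : ∀ k, Tendsto (fun T => (m T k : ℝ) / A k T) atTop (𝓝 (C k + 1)) := fun k =>
    (tendsto_nat_ceil_mul_div_atTop (by linarith [hC k])).comp (hA k)
  have hg' : ∀ᶠ T in atTop, ∀ k, Measurable (g k T) := eventually_all.mpr hg
  set V : (T : ℕ) → (ℕ → Fin K × ℝ) → ℂ := fun T ω =>
    compExp (fun k => g k T) (m T) (φ T) T (truncate T ω) with hV
  set E : (T : ℕ) → (ℕ → Fin K × ℝ) → ℂ := fun T ω =>
    Complex.exp ((∑ t, g (truncate T ω t).1 T (truncate T ω t).2 : ℝ) * Complex.I) with hE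
  -- The limit of the compensator: deterministic and nonzero, so it can be divided out at the end.
  set d : ℂ := ∏ k, Complex.exp ((1 : ℝ) * ψ k) with hd
  have hd0 : d ≠ 0 := Finset.prod_ne_zero_iff.mpr fun k _ => Complex.exp_ne_zero _
  have hEn : ∀ T ω, ‖E T ω‖ = 1 := fun T ω => Complex.norm_exp_ofReal_mul_I _
  have hVint : ∀ᶠ T in atTop, ∫ ω, V T ω ∂(M.pathLaw pol θ) = ∏ k, φ T k ^ m T k := by
    filter_upwards [hg'] with T hT
    rw [hV, ← M.integral_lawUpTo pol θ T (measurable_compExp hT _ _ _)]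
    exact M.integral_compExp pol θ hT _ (fun k => rfl) (hφ1 T) T
  have hVlim : Tendsto (fun T => ∏ k, φ T k ^ m T k) atTop
      (𝓝 (∏ k, Complex.exp ((C k + 1 : ℝ) * ψ k))) :=
    tendsto_finsetProd _ fun k _ => tendsto_pow_exp_of_tendsto_mul_sub_one (hA k) (hψ k) (hmA k)
  have hVm : ∀ᶠ T in atTop, Measurable (V T) := by
    filter_upwards [hg'] with T hT
    exact (measurable_compExp hT _ _ _).comp (measurable_truncate T)
  have hEm0 : ∀ᶠ T in atTop, Measurable fun x : Fin T → Fin K × ℝ =>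
      Complex.exp ((∑ t, g (x t).1 T (x t).2 : ℝ) * Complex.I) := by
    filter_upwards [hg'] with T hT
    exact ((Complex.measurable_ofReal.comp (measurable_sum_apply hT T)).mul_const _).cexp
  have hEm : ∀ᶠ T in atTop, Measurable (E T) := by
    filter_upwards [hEm0] with T hT
    exact hT.comp (measurable_truncate T)
  -- Pathwise, the truncated exponential eventually equals the full one `E`, of modulus one, and
  -- only the compensator still varies.
  have hae : ∀ᵐ ω ∂(M.pathLaw pol θ), Tendsto (fun T => V T ω - E T ω * d) atTop (𝓝 0) := by
    filter_upwards [ae_all_iff.mpr hD] with ω hω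
    have hle : ∀ᶠ T in atTop, ∀ k, pulls k (truncate T ω) ≤ m T k := by
      refine eventually_all.mpr fun k => ?_
      have h := (hω k).eventually_lt (hmA k) (by linarith)
      filter_upwards [h, (hA k).eventually_gt_atTop 0] with T hT hT0
      exact_mod_cast ((div_lt_div_iff_of_pos_right hT0).mp hT).le
    have hlim : Tendsto (fun T => ∏ k, φ T k ^ (m T k - pulls k (truncate T ω))) atTop (𝓝 d) := by
      refine tendsto_finsetProd _ fun k _ =>
        tendsto_pow_exp_of_tendsto_mul_sub_one (hA k) (hψ k) ?_
      have h := (hmA k).sub (hω k)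
      rw [add_sub_cancel_left] at h
      refine h.congr' ?_
      filter_upwards [hle] with T hT
      rw [Nat.cast_sub (hT k), sub_div]
    have h0 : Tendsto (fun T => E T ω *
        (∏ k, φ T k ^ (m T k - pulls k (truncate T ω)) - d)) atTop (𝓝 0) := by
      rw [tendsto_zero_iff_norm_tendsto_zero]
      simp only [norm_mul, hEn, one_mul]
      exact tendsto_zero_iff_norm_tendsto_zero.mp (tendsto_sub_nhds_zero_iff.mpr hlim)
    refine h0.congr' ?_
    filter_upwards [hle] with T hT
    simp only [hV, hE, compExp]
    rw [truncExp_of_pulls_le _ _ _ _ hT]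
    ring
  have hdiff : Tendsto (fun T => ∫ ω, (V T ω - E T ω * d) ∂(M.pathLaw pol θ)) atTop (𝓝 0) := by
    have := tendsto_integral_filter_of_dominated_convergence (μ := M.pathLaw pol θ)
      (F := fun T ω => V T ω - E T ω * d) (f := fun _ => 0) (l := atTop) (fun _ => 1 + ‖d‖)
      (by
        filter_upwards [hVm, hEm] with T h1 h2
        exact (h1.sub (h2.mul_const d)).aestronglyMeasurable)
      (Eventually.of_forall fun T => ae_of_all _ fun ω => by
        refine (norm_sub_le _ _).trans (add_le_add (norm_compExp_le _ _ (hφ1 T) _ _) ?_)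
        rw [norm_mul, hEn, one_mul])
      (integrable_const _) hae
    simpa using this
  have hsub : Tendsto (fun T => (∫ ω, E T ω ∂(M.pathLaw pol θ)) * d) atTop
      (𝓝 (∏ k, Complex.exp ((C k + 1 : ℝ) * ψ k))) := by
    have h := hVlim.sub hdiff
    rw [sub_zero] at h
    refine h.congr' ?_
    filter_upwards [hVint, hVm, hEm] with T hT h1 h2
    have i1 : Integrable (V T) (M.pathLaw pol θ) :=
      .of_bound (C := 1) h1.aestronglyMeasurable
        (ae_of_all _ fun ω => norm_compExp_le _ _ (hφ1 T) _ _)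
    have i2 : Integrable (E T) (M.pathLaw pol θ) :=
      .of_bound (C := 1) h2.aestronglyMeasurable (ae_of_all _ fun ω => (hEn T ω).le)
    rw [integral_sub i1 (i2.mul_const d), hT, integral_mul_const]
    ring
  have hfin := hsub.div_const d
  have e : (∏ k, Complex.exp ((C k + 1 : ℝ) * ψ k)) / d = Complex.exp (∑ k, C k * ψ k) := by
    rw [div_eq_iff hd0, hd, ← Complex.exp_sum, ← Complex.exp_sum, ← Complex.exp_add,
      ← Finset.sum_add_distrib]
    congr 1
    refine Finset.sum_congr rfl fun k _ => ?_
    push_cast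
    ring
  rw [e] at hfin
  refine hfin.congr' ?_
  filter_upwards [hEm0] with T hT
  rw [M.integral_lawUpTo pol θ T hT, mul_div_cancel_right₀ _ hd0]

end ArmModel

/-! ### Second order expansion of the exponential of a log-likelihood -/

/-- The remainder of the second order expansion of `exp (i (2 u log (1 + w / 2) + s))`. -/
def expRemainder (u w s : ℝ) : ℂ :=
  Complex.exp ((2 * u * Real.log (1 + w / 2) + s : ℝ) * Complex.I) - 1 - (u * w + s) * Complex.I
    + u * w ^ 2 / 4 * Complex.I + (u * w + s) ^ 2 / 2

lemma isLittleO_log_one_add_half :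
    (fun w : ℝ => 2 * Real.log (1 + w / 2) - w + w ^ 2 / 4) =o[𝓝 0] fun w => w ^ 2 := by
  have h : (fun x : ℝ => Real.log (1 + x) - x + x ^ 2 / 2) =O[𝓝 0] fun x => x ^ 3 := by
    refine IsBigO.of_bound 2 ?_
    filter_upwards [Metric.ball_mem_nhds (0 : ℝ) (by norm_num : (0 : ℝ) < 1 / 2)] with x hx
    rw [Metric.mem_ball, dist_zero_right, Real.norm_eq_abs] at hx
    have h := Real.abs_log_sub_add_sum_range_le (x := -x) (by rw [abs_neg]; linarith) 2
    simp only [Finset.sum_range_succ, Finset.sum_range_zero, abs_neg] at h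
    norm_num at h
    rw [Real.norm_eq_abs, Real.norm_eq_abs, abs_pow]
    calc |Real.log (1 + x) - x + x ^ 2 / 2| = |-x + x ^ 2 / 2 + Real.log (1 + x)| := by ring_nf
      _ ≤ |x| ^ 3 / (1 - |x|) := h
      _ ≤ 2 * |x| ^ 3 := by
        rw [div_le_iff₀ (by linarith)]
        nlinarith [pow_nonneg (abs_nonneg x) 3]
  have hlim : Tendsto (fun w : ℝ => w / 2) (𝓝 0) (𝓝 0) := by
    have : Continuous fun w : ℝ => w / 2 := by fun_prop
    simpa using this.tendsto 0
  have h2 := (h.comp_tendsto hlim).const_mul_left 2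
  have h3 : (fun x : ℝ => (x / 2) ^ 3) =o[𝓝 0] fun w => w ^ 2 := by
    have : (fun x : ℝ => x ^ 3) =o[𝓝 0] fun w : ℝ => w ^ 2 := isLittleO_pow_pow (by norm_num)
    refine (this.const_mul_left (1 / 8)).congr_left fun x => by ring
  refine (h2.trans_isLittleO h3).congr_left fun w => ?_
  simp only [Function.comp_apply]
  ring

lemma isLittleO_exp_mul_I :
    (fun x : ℝ => Complex.exp (x * Complex.I) - 1 - x * Complex.I + x ^ 2 / 2) =o[𝓝 0]
      fun x => x ^ 2 := by
  have h : (fun x : ℝ => Complex.exp (x * Complex.I) - 1 - x * Complex.I + x ^ 2 / 2) =O[𝓝 0]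
      fun x => x ^ 3 := by
    refine IsBigO.of_bound 1 ?_
    filter_upwards [Metric.ball_mem_nhds (0 : ℝ) one_pos] with x hx
    rw [Metric.mem_ball, dist_zero_right, Real.norm_eq_abs] at hx
    have h := Complex.exp_bound (x := x * Complex.I) (by simpa using hx.le) (n := 3) (by norm_num)
    simp only [Finset.sum_range_succ, Finset.sum_range_zero] at h
    norm_num [mul_pow, Nat.factorial] at h
    rw [norm_pow, Real.norm_eq_abs, one_mul]
    calc ‖Complex.exp (x * Complex.I) - 1 - x * Complex.I + x ^ 2 / 2‖
        = ‖Complex.exp (x * Complex.I) - (1 + x * Complex.I + -(x ^ 2 : ℂ) / 2)‖ := by ring_nf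
      _ ≤ |x| ^ 3 * (2 / 9) := h
      _ ≤ |x| ^ 3 := by nlinarith [pow_nonneg (abs_nonneg x) 3]
  exact h.trans_isLittleO (isLittleO_pow_pow (by norm_num))

lemma isLittleO_expRemainder (u : ℝ) :
    (fun z : ℝ × ℝ => expRemainder u z.1 z.2) =o[𝓝 0] fun z => z.1 ^ 2 + z.2 ^ 2 := by
  have hfst : Tendsto (Prod.fst : ℝ × ℝ → ℝ) (𝓝 0) (𝓝 0) := continuous_fst.tendsto 0
  have hN : ∀ z : ℝ × ℝ, ‖z‖ ^ 2 ≤ z.1 ^ 2 + z.2 ^ 2 := fun z => by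
    rw [Prod.norm_def]
    rcases max_cases ‖z.1‖ ‖z.2‖ with ⟨h, -⟩ | ⟨h, -⟩ <;> rw [h, Real.norm_eq_abs, sq_abs] <;>
      nlinarith [sq_nonneg z.1, sq_nonneg z.2]
  have hQ : (fun z : ℝ × ℝ => ‖z‖ ^ 2) =O[𝓝 0] fun z => z.1 ^ 2 + z.2 ^ 2 :=
    IsBigO.of_bound 1 (Eventually.of_forall fun z => by
      rw [Real.norm_of_nonneg (by positivity), Real.norm_of_nonneg (by positivity), one_mul]
      exact hN z)
  have h1 : (fun z : ℝ × ℝ => z.1) =O[𝓝 0] fun z => ‖z‖ := isBigO_fst_prod'.norm_right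
  have h2 : (fun z : ℝ × ℝ => z.2) =O[𝓝 0] fun z => ‖z‖ := isBigO_snd_prod'.norm_right
  have hlin : (fun z : ℝ × ℝ => u * z.1 + z.2) =O[𝓝 0] fun z => ‖z‖ :=
    (h1.const_mul_left u).add h2
  have hsq : (fun z : ℝ × ℝ => z.1 ^ 2) =O[𝓝 0] fun z => ‖z‖ ^ 2 := h1.pow 2
  set X : ℝ × ℝ → ℝ := fun z => 2 * u * Real.log (1 + z.1 / 2) + z.2 with hX
  have hlog : (fun z : ℝ × ℝ => X z - (u * z.1 + z.2) + u * z.1 ^ 2 / 4) =o[𝓝 0]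
      fun z => ‖z‖ ^ 2 := by
    refine (((isLittleO_log_one_add_half.comp_tendsto hfst).const_mul_left u).trans_isBigO
      hsq).congr_left fun z => ?_
    simp only [hX, Function.comp_apply]
    ring
  have hd : (fun z : ℝ × ℝ => X z - (u * z.1 + z.2)) =O[𝓝 0] fun z => ‖z‖ ^ 2 := by
    refine (hlog.isBigO.sub (hsq.const_mul_left (u / 4))).congr_left fun z => by ring
  have hsmall : (fun z : ℝ × ℝ => ‖z‖ ^ 2) =o[𝓝 0] fun z => ‖z‖ := by
    have := (isLittleO_pow_pow (𝕜 := ℝ) (m := 1) (n := 2) (by norm_num)).comp_tendsto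
      (tendsto_norm_zero (E := ℝ × ℝ))
    simpa [Function.comp_def] using this
  have hXO : X =O[𝓝 0] fun z => ‖z‖ :=
    ((hd.trans hsmall.isBigO).add hlin).congr_left fun z => by ring
  have hX0 : Tendsto X (𝓝 0) (𝓝 0) := hXO.trans_tendsto tendsto_norm_zero
  have hexp := (isLittleO_exp_mul_I.comp_tendsto hX0).trans_isBigO (hXO.pow 2)
  have hsqd : (fun z : ℝ × ℝ => (X z - (u * z.1 + z.2)) * (X z + (u * z.1 + z.2))) =o[𝓝 0]
      fun z => ‖z‖ ^ 2 := by
    refine ((hd.trans_isLittleO hsmall).mul_isBigO (hXO.add hlin)).congr_right fun z => by ring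
  -- With L = u w + s, the remainder is [exp(iX) - 1 - iX + X²/2] + i[X - L + u w²/4] - (X² - L²)/2,
  -- and each term is o(‖z‖²).
  have hR : (fun z : ℝ × ℝ => expRemainder u z.1 z.2) =o[𝓝 0] fun z => ‖z‖ ^ 2 := by
    have c1 : (fun z : ℝ × ℝ => ((X z - (u * z.1 + z.2) + u * z.1 ^ 2 / 4 : ℝ) : ℂ) * Complex.I)
        =o[𝓝 0] fun z => ‖z‖ ^ 2 := by
      rw [← isLittleO_norm_left] at hlog ⊢
      simpa only [norm_mul, Complex.norm_I, mul_one, Complex.norm_real] using hlog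
    have c2 : (fun z : ℝ × ℝ => (((X z - (u * z.1 + z.2)) * (X z + (u * z.1 + z.2)) : ℝ) : ℂ) / 2)
        =o[𝓝 0] fun z => ‖z‖ ^ 2 := by
      have : (fun z : ℝ × ℝ => (((X z - (u * z.1 + z.2)) * (X z + (u * z.1 + z.2)) : ℝ) : ℂ))
        =o[𝓝 0] fun z => ‖z‖ ^ 2 := by
        rw [← isLittleO_norm_left] at hsqd ⊢
        simpa only [Complex.norm_real] using hsqd
      exact (this.const_mul_left (1 / 2)).congr_left fun z => by ring
    refine ((hexp.add c1).sub c2).congr_left fun z => ?_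
    simp only [expRemainder, Function.comp_apply, hX]
    push_cast
    ring
  exact hR.trans_isBigO hQ

/-- The exponential has modulus one whatever real value the logarithm takes, so the bound holds also
where 1 + w/2 is small or not positive. -/
lemma norm_expRemainder_le (u w s : ℝ) :
    ‖expRemainder u w s‖ ≤ 2 + |u| * |w| + |s| + |u| * w ^ 2 + (u * w + s) ^ 2 := by
  unfold expRemainder
  have h1 := Complex.norm_exp_ofReal_mul_I (2 * u * Real.log (1 + w / 2) + s)
  have h2 : ‖((u : ℂ) * w + s) * Complex.I‖ ≤ |u| * |w| + |s| := by
    rw [norm_mul, Complex.norm_I, mul_one]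
    refine (norm_add_le _ _).trans ?_
    simp
  have h3 : ‖(u : ℂ) * w ^ 2 / 4 * Complex.I‖ ≤ |u| * w ^ 2 := by
    have : ‖(u : ℂ) * w ^ 2 / 4 * Complex.I‖ = |u| * w ^ 2 / 4 := by simp
    rw [this]
    nlinarith [abs_nonneg u, sq_nonneg w, mul_nonneg (abs_nonneg u) (sq_nonneg w)]
  have h4 : ‖((u : ℂ) * w + s) ^ 2 / 2‖ ≤ (u * w + s) ^ 2 := by
    have : ((u : ℂ) * w + s) ^ 2 / 2 = (((u * w + s) ^ 2 / 2 : ℝ) : ℂ) := by push_cast; ring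
    rw [this, Complex.norm_real, Real.norm_of_nonneg (by positivity)]
    nlinarith [sq_nonneg (u * w + s)]
  calc _ ≤ ‖Complex.exp ((2 * u * Real.log (1 + w / 2) + s : ℝ) * Complex.I)‖ + ‖(1 : ℂ)‖ +
        ‖((u : ℂ) * w + s) * Complex.I‖ + ‖(u : ℂ) * w ^ 2 / 4 * Complex.I‖ +
        ‖((u : ℂ) * w + s) ^ 2 / 2‖ := by
        refine (norm_add_le _ _).trans (add_le_add_left ?_ _)
        refine (norm_add_le _ _).trans (add_le_add_left ?_ _)
        refine (norm_sub_le _ _).trans (add_le_add_left ?_ _)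
        exact norm_sub_le _ _
    _ ≤ _ := by
        rw [h1, norm_one]
        linarith

/-- The remainder is small compared to `w ^ 2 + s ^ 2` near the origin, and bounded by a multiple
of it elsewhere. -/
lemma exists_norm_expRemainder_le (u : ℝ) {ε : ℝ} (hε : 0 < ε) :
    ∃ δ > 0, ∃ C ≥ 0, ∀ w s : ℝ, ‖expRemainder u w s‖ ≤ C * (w ^ 2 + s ^ 2) ∧
      (w ^ 2 + s ^ 2 ≤ δ ^ 2 → ‖expRemainder u w s‖ ≤ ε * (w ^ 2 + s ^ 2)) := by
  have h := (isLittleO_expRemainder u).def hε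
  obtain ⟨r, hr, hball⟩ := Metric.eventually_nhds_iff.mp h
  set δ := r / 2 with hδ
  have hδ0 : 0 < δ := by positivity
  have hin : ∀ w s : ℝ, w ^ 2 + s ^ 2 ≤ δ ^ 2 →
      ‖expRemainder u w s‖ ≤ ε * (w ^ 2 + s ^ 2) := fun w s hws => by
    have hw : |w| ≤ δ := abs_le_of_sq_le_sq (by nlinarith [sq_nonneg s]) hδ0.le
    have hs : |s| ≤ δ := abs_le_of_sq_le_sq (by nlinarith [sq_nonneg w]) hδ0.le
    have hd : dist (w, s) (0 : ℝ × ℝ) < r := by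
      rw [dist_zero_right, Prod.norm_def]
      exact max_lt (by simp only [Real.norm_eq_abs]; linarith)
        (by simp only [Real.norm_eq_abs]; linarith)
    have := hball hd
    rwa [Real.norm_of_nonneg (by positivity)] at this
  -- Outside the ball of radius δ the constant part 3 + |u|² of the crude bound is at most (3 +
  -- |u|²)(w² + s²)/δ²; the second summand collects the coefficients of w² and s².
  refine ⟨δ, hδ0, max ε ((3 + |u| ^ 2) / δ ^ 2 + (1 + |u| + 2 * u ^ 2 + 2)), by positivity,
    fun w s => ⟨?_, hin w s⟩⟩
  rcases le_or_gt (w ^ 2 + s ^ 2) (δ ^ 2) with hws | hws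
  · exact (hin w s hws).trans (mul_le_mul_of_nonneg_right (le_max_left _ _) (by positivity))
  · refine le_trans ?_ (mul_le_mul_of_nonneg_right (le_max_right _ _) (by positivity))
    refine (norm_expRemainder_le u w s).trans ?_
    have h1 : 1 ≤ (w ^ 2 + s ^ 2) / δ ^ 2 := by
      rw [le_div_iff₀ (by positivity)]
      linarith
    have h2 : |u| * |w| ≤ |u| ^ 2 + w ^ 2 := by
      nlinarith [sq_nonneg (|u| - |w|), sq_abs w, sq_nonneg (|u|), sq_nonneg (|w|)]
    have h3 : |s| ≤ 1 + s ^ 2 := by nlinarith [sq_nonneg (|s| - 1), sq_abs s]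
    have h4 : (u * w + s) ^ 2 ≤ 2 * u ^ 2 * w ^ 2 + 2 * s ^ 2 := by
      nlinarith [sq_nonneg (u * w - s)]
    have h5 : (3 + |u| ^ 2) ≤ (3 + |u| ^ 2) * ((w ^ 2 + s ^ 2) / δ ^ 2) :=
      le_mul_of_one_le_right (by positivity) h1
    have e : ((3 + |u| ^ 2) / δ ^ 2 + (1 + |u| + 2 * u ^ 2 + 2)) * (w ^ 2 + s ^ 2) =
      (3 + |u| ^ 2) * ((w ^ 2 + s ^ 2) / δ ^ 2) +
        (1 + |u| + 2 * u ^ 2 + 2) * (w ^ 2 + s ^ 2) := by ring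
    rw [e]
    have h6 : 0 ≤ (|u| + 2 * u ^ 2) * s ^ 2 := by positivity
    nlinarith [sq_nonneg w, sq_nonneg s]

/-! ### Passing to the limit under L² convergence -/

section SquareIntegrable

variable {Ω ι : Type*} [MeasurableSpace Ω] {μ : Measure Ω} {l : Filter ι}

/-- Cauchy–Schwarz, from the discriminant of t ↦ ∫ (X + tY)² ≥ 0. -/
lemma sq_integral_mul_le {X Y : Ω → ℝ} (hX : MemLp X 2 μ) (hY : MemLp Y 2 μ) :
    (∫ z, X z * Y z ∂μ) ^ 2 ≤ (∫ z, X z ^ 2 ∂μ) * ∫ z, Y z ^ 2 ∂μ := by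
  have hXY : Integrable (fun z => X z * Y z) μ := hX.integrable_mul hY
  have h : ∀ t : ℝ, 0 ≤ (∫ z, Y z ^ 2 ∂μ) * (t * t) + (2 * ∫ z, X z * Y z ∂μ) * t +
      ∫ z, X z ^ 2 ∂μ := fun t => by
    have e : ∫ z, (X z + t * Y z) ^ 2 ∂μ = (∫ z, Y z ^ 2 ∂μ) * (t * t) +
        (2 * ∫ z, X z * Y z ∂μ) * t + ∫ z, X z ^ 2 ∂μ := by
      calc ∫ z, (X z + t * Y z) ^ 2 ∂μ
          = ∫ z, (Y z ^ 2 * (t * t) + (X z * Y z) * (2 * t)) + X z ^ 2 ∂μ :=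
            integral_congr_ae (ae_of_all _ fun z => by ring)
        _ = _ := by
          have h1 : Integrable (fun z => Y z ^ 2 * (t * t)) μ := hY.integrable_sq.mul_const _
          have h2 : Integrable (fun z => X z * Y z * (2 * t)) μ := hXY.mul_const _
          have h3 : Integrable (fun z => Y z ^ 2 * (t * t) + X z * Y z * (2 * t)) μ := h1.add h2
          rw [integral_add h3 hX.integrable_sq, integral_add h1 h2, integral_mul_const,
            integral_mul_const]
          ring
    rw [← e]
    exact integral_nonneg fun z => sq_nonneg _
  have := discrim_le_zero h
  rw [discrim] at this
  nlinarith

lemma tendsto_integral_mul_of_tendsto_sq {X : ι → Ω → ℝ} {X₀ Y : Ω → ℝ}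
    (hX : ∀ᶠ i in l, MemLp (X i) 2 μ) (hX₀ : MemLp X₀ 2 μ) (hY : MemLp Y 2 μ)
    (h : Tendsto (fun i => ∫ z, (X i z - X₀ z) ^ 2 ∂μ) l (𝓝 0)) :
    Tendsto (fun i => ∫ z, X i z * Y z ∂μ) l (𝓝 (∫ z, X₀ z * Y z ∂μ)) := by
  rw [← tendsto_sub_nhds_zero_iff]
  have h0 : Tendsto (fun i => Real.sqrt ((∫ z, (X i z - X₀ z) ^ 2 ∂μ) * ∫ z, Y z ^ 2 ∂μ)) l
      (𝓝 0) := by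
    have := (h.mul_const (∫ z, Y z ^ 2 ∂μ)).sqrt
    simpa using this
  refine squeeze_zero_norm' ?_ h0
  filter_upwards [hX] with i hi
  have h1 : Integrable (fun z => X i z * Y z) μ := hi.integrable_mul hY
  have h2 : Integrable (fun z => X₀ z * Y z) μ := hX₀.integrable_mul hY
  rw [← integral_sub h1 h2, Real.norm_eq_abs]
  refine Real.abs_le_sqrt ?_
  simp_rw [← sub_mul]
  exact sq_integral_mul_le (hi.sub hX₀) hY

lemma tendsto_integral_sq_of_tendsto_sq {X : ι → Ω → ℝ} {X₀ : Ω → ℝ}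
    (hX : ∀ᶠ i in l, MemLp (X i) 2 μ) (hX₀ : MemLp X₀ 2 μ)
    (h : Tendsto (fun i => ∫ z, (X i z - X₀ z) ^ 2 ∂μ) l (𝓝 0)) :
    Tendsto (fun i => ∫ z, X i z ^ 2 ∂μ) l (𝓝 (∫ z, X₀ z ^ 2 ∂μ)) := by
  have h1 := (h.add ((tendsto_integral_mul_of_tendsto_sq hX hX₀ hX₀ h).const_mul 2)).sub_const
    (∫ z, X₀ z ^ 2 ∂μ)
  have e : 0 + 2 * (∫ z, X₀ z * X₀ z ∂μ) - ∫ z, X₀ z ^ 2 ∂μ = ∫ z, X₀ z ^ 2 ∂μ := by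
    simp_rw [← pow_two]
    ring
  rw [e] at h1
  refine h1.congr' ?_
  filter_upwards [hX] with i hi
  have e : ∀ z, X i z ^ 2 = (X i z - X₀ z) ^ 2 + 2 * (X i z * X₀ z) - X₀ z ^ 2 := fun z => by ring
  have i1 : Integrable (fun z => (X i z - X₀ z) ^ 2) μ := (hi.sub hX₀).integrable_sq
  have i2 : Integrable (fun z => 2 * (X i z * X₀ z)) μ := (hi.integrable_mul hX₀).const_mul 2
  have i3 : Integrable (fun z => (X i z - X₀ z) ^ 2 + 2 * (X i z * X₀ z)) μ := i1.add i2
  rw [integral_congr_ae (ae_of_all _ e), integral_sub i3 hX₀.integrable_sq, integral_add i1 i2,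
    integral_const_mul]

lemma measurable_expRemainder (u : ℝ) {w s : Ω → ℝ} (hw : Measurable w) (hs : Measurable s) :
    Measurable fun z => expRemainder u (w z) (s z) := by
  unfold expRemainder
  fun_prop

lemma integrable_expRemainder (u : ℝ) {w s : Ω → ℝ} (hwm : Measurable w) (hsm : Measurable s)
    (hw : MemLp w 2 μ) (hs : MemLp s 2 μ) :
    Integrable (fun z => expRemainder u (w z) (s z)) μ := by
  obtain ⟨δ, -, C, -, h⟩ := exists_norm_expRemainder_le u one_pos
  exact ((hw.integrable_sq.add hs.integrable_sq).const_mul C).mono'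
    (measurable_expRemainder u hwm hsm).aestronglyMeasurable (ae_of_all _ fun z => (h _ _).1)

variable [IsProbabilityMeasure μ]

/-- Where w² + (S/a)² is small the remainder costs at most ε((aw)² + S²) after scaling by a². The
exceptional set has vanishing probability by Markov's inequality; there (aw)² is replaced by the
fixed integrable 2η² plus twice the L² error. -/
lemma tendsto_integral_expRemainder (u : ℝ) {a : ι → ℝ} (ha : Tendsto a l atTop)
    {w : ι → Ω → ℝ} {η S : Ω → ℝ} (hwm : ∀ᶠ i in l, Measurable (w i)) (hSm : Measurable S)
    (hw : ∀ᶠ i in l, MemLp (w i) 2 μ) (hη : MemLp η 2 μ) (hS : MemLp S 2 μ)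
    (h : Tendsto (fun i => ∫ z, (a i * w i z - η z) ^ 2 ∂μ) l (𝓝 0)) :
    Tendsto (fun i => (a i : ℂ) ^ 2 * ∫ z, expRemainder u (w i z) (S z / a i) ∂μ) l (𝓝 0) := by
  have haw : ∀ᶠ i in l, MemLp (fun z => a i * w i z) 2 μ := hw.mono fun i hi => hi.const_mul _
  have hsq := tendsto_integral_sq_of_tendsto_sq haw hη h
  have ha0 := ha.eventually_gt_atTop 0
  rw [Metric.tendsto_nhds]
  intro ε' hε'
  set c := (∫ z, η z ^ 2 ∂μ) + ∫ z, S z ^ 2 ∂μ with hc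
  have hc0 : 0 ≤ c := add_nonneg (integral_nonneg fun _ => sq_nonneg _)
    (integral_nonneg fun _ => sq_nonneg _)
  set ε := ε' / (c + 1) with hε
  have hε0 : 0 < ε := by positivity
  obtain ⟨δ, hδ, C, hC, hR⟩ := exists_norm_expRemainder_le u hε0
  set B : ι → Set Ω := fun i => {z | δ ^ 2 ≤ w i z ^ 2 + (S z / a i) ^ 2} with hB
  have hBm : ∀ᶠ i in l, MeasurableSet (B i) := by
    filter_upwards [hwm] with i hi
    exact measurableSet_le measurable_const ((hi.pow_const 2).add ((hSm.div_const _).pow_const 2))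
  have hBr : Tendsto (fun i => μ.real (B i)) l (𝓝 0) := by
    have hinv : Tendsto (fun i => ((a i)⁻¹) ^ 2 / δ ^ 2) l (𝓝 0) := by
      have := ((tendsto_inv_atTop_zero.comp ha).pow 2).div_const (δ ^ 2)
      simpa [Function.comp_def] using this
    have hb := hinv.mul (hsq.add_const (∫ z, S z ^ 2 ∂μ))
    rw [zero_mul] at hb
    refine squeeze_zero' (Eventually.of_forall fun i => measureReal_nonneg) ?_ hb
    filter_upwards [hw, ha0, haw] with i hi hai hawi
    have hm := mul_meas_ge_le_integral_of_nonneg (μ := μ)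
      (f := fun z => ((a i)⁻¹) ^ 2 * ((a i * w i z) ^ 2 + S z ^ 2))
      (ae_of_all _ fun z => by positivity)
      ((hawi.integrable_sq.add hS.integrable_sq).const_mul _) (δ ^ 2)
    rw [integral_const_mul, integral_add hawi.integrable_sq hS.integrable_sq] at hm
    have e : {z | δ ^ 2 ≤ ((a i)⁻¹) ^ 2 * ((a i * w i z) ^ 2 + S z ^ 2)} = B i := by
      ext z
      have : ((a i)⁻¹) ^ 2 * ((a i * w i z) ^ 2 + S z ^ 2) = w i z ^ 2 + (S z / a i) ^ 2 := by
        field_simp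
      simp only [hB, Set.mem_ofPred_eq, this]
    rw [e] at hm
    rw [div_mul_eq_mul_div, le_div_iff₀ (by positivity), mul_comm]
    exact hm
  have hBμ : Tendsto (μ ∘ B) l (𝓝 0) := by
    have := (ENNReal.continuous_ofReal.tendsto 0).comp hBr
    simpa [Function.comp_def, ofReal_measureReal] using this
  have hG : Integrable (fun z => C * (2 * η z ^ 2 + S z ^ 2)) μ :=
    ((hη.integrable_sq.const_mul 2).add hS.integrable_sq).const_mul C
  have hBint := hG.tendsto_setIntegral_nhds_zero hBμ
  have hub := (((hsq.add_const (∫ z, S z ^ 2 ∂μ)).const_mul ε).add (h.const_mul (2 * C))).add hBint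
  -- The choice ε = ε'/(c + 1) leaves a strict inequality in the limit, also when c = 0.
  have hlt : ε * ((∫ z, η z ^ 2 ∂μ) + ∫ z, S z ^ 2 ∂μ) + 2 * C * 0 + 0 < ε' := by
    rw [← hc, mul_zero, add_zero, add_zero, hε, div_mul_eq_mul_div, div_lt_iff₀ (by positivity)]
    nlinarith
  filter_upwards [hub.eventually_lt_const hlt, hw, hwm, ha0, haw, hBm] with i hi hwi hwmi hai hawi
    hBi
  have hs : MemLp (fun z => S z / a i) 2 μ := by
    simpa [div_eq_inv_mul] using hS.const_mul (a i)⁻¹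
  have hsm : Measurable fun z => S z / a i := hSm.div_const _
  have hint := integrable_expRemainder (μ := μ) u hwmi hsm hwi hs
  rw [dist_zero_right, norm_mul, norm_pow, Complex.norm_real, Real.norm_of_nonneg hai.le]
  refine lt_of_le_of_lt ?_ hi
  have hd : Integrable (fun z => (a i * w i z - η z) ^ 2) μ := (hawi.sub hη).integrable_sq
  have hI1 : Integrable (fun z => ε * ((a i * w i z) ^ 2 + S z ^ 2)) μ :=
    (hawi.integrable_sq.add hS.integrable_sq).const_mul ε
  have hI2 : Integrable (fun z => 2 * C * (a i * w i z - η z) ^ 2) μ := hd.const_mul _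
  have hI3 : Integrable ((B i).indicator fun z => C * (2 * η z ^ 2 + S z ^ 2)) μ := hG.indicator hBi
  calc a i ^ 2 * ‖∫ z, expRemainder u (w i z) (S z / a i) ∂μ‖
      ≤ a i ^ 2 * ∫ z, ‖expRemainder u (w i z) (S z / a i)‖ ∂μ :=
        mul_le_mul_of_nonneg_left (norm_integral_le_integral_norm _) (by positivity)
    _ = ∫ z, a i ^ 2 * ‖expRemainder u (w i z) (S z / a i)‖ ∂μ := (integral_const_mul _ _).symm
    _ ≤ ∫ z, (ε * ((a i * w i z) ^ 2 + S z ^ 2) + 2 * C * (a i * w i z - η z) ^ 2) +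
        (B i).indicator (fun z => C * (2 * η z ^ 2 + S z ^ 2)) z ∂μ := by
        refine integral_mono (hint.norm.const_mul _) ((hI1.add hI2).add hI3) fun z => ?_
        have e : a i ^ 2 * (w i z ^ 2 + (S z / a i) ^ 2) = (a i * w i z) ^ 2 + S z ^ 2 := by
          field_simp
        obtain ⟨r1, r2⟩ := hR (w i z) (S z / a i)
        simp only
        by_cases hz : z ∈ B i
        · rw [Set.indicator_of_mem hz]
          have h1 := mul_le_mul_of_nonneg_left r1 (sq_nonneg (a i))
          rw [mul_left_comm, e] at h1
          have h2 : (a i * w i z) ^ 2 ≤ 2 * (a i * w i z - η z) ^ 2 + 2 * η z ^ 2 := by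
            -- The difference of the two sides is exactly (aw - 2η)².
            nlinarith [sq_nonneg (a i * w i z - 2 * η z)]
          have h3 : C * ((a i * w i z) ^ 2 + S z ^ 2) ≤
              C * ((2 * (a i * w i z - η z) ^ 2 + 2 * η z ^ 2) + S z ^ 2) :=
            mul_le_mul_of_nonneg_left (by linarith) hC
          have h4 : 0 ≤ ε * ((a i * w i z) ^ 2 + S z ^ 2) := by positivity
          nlinarith
        · rw [Set.indicator_of_notMem hz, add_zero]
          have h1 := mul_le_mul_of_nonneg_left (r2 (not_le.mp hz).le) (sq_nonneg (a i))
          rw [mul_left_comm, e] at h1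
          have h4 : 0 ≤ 2 * C * (a i * w i z - η z) ^ 2 := by positivity
          linarith
    _ = _ := by
        have hI12 : Integrable (fun z => ε * ((a i * w i z) ^ 2 + S z ^ 2) +
            2 * C * (a i * w i z - η z) ^ 2) μ := hI1.add hI2
        rw [integral_add hI12 hI3, integral_add hI1 hI2, integral_const_mul,
          integral_const_mul, integral_add hawi.integrable_sq hS.integrable_sq,
          integral_indicator hBi]

/-- Second order expansion of the characteristic function of `2 u log (1 + w / 2) + S / a`, when
`a w → η` in `L²`. -/
theorem tendsto_mul_integral_exp_sub_one (u : ℝ) {a : ι → ℝ} (ha : Tendsto a l atTop)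
    {w : ι → Ω → ℝ} {η S : Ω → ℝ} {β : ℝ} (hwm : ∀ᶠ i in l, Measurable (w i))
    (hSm : Measurable S) (hw : ∀ᶠ i in l, MemLp (w i) 2 μ) (hη : MemLp η 2 μ) (hS : MemLp S 2 μ)
    (h : Tendsto (fun i => ∫ z, (a i * w i z - η z) ^ 2 ∂μ) l (𝓝 0))
    (hβ : Tendsto (fun i => a i ^ 2 * ∫ z, w i z ∂μ) l (𝓝 β)) (hS0 : ∫ z, S z ∂μ = 0) :
    Tendsto (fun i => ((a i ^ 2 : ℝ) : ℂ) * ((∫ z, Complex.exp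
        ((2 * u * Real.log (1 + w i z / 2) + S z / a i : ℝ) * Complex.I) ∂μ) - 1)) l
      (𝓝 ((u * β - u / 4 * ∫ z, η z ^ 2 ∂μ : ℝ) * Complex.I -
        ((∫ z, (u * η z + S z) ^ 2 ∂μ) / 2 : ℝ))) := by
  have haw : ∀ᶠ i in l, MemLp (fun z => a i * w i z) 2 μ := hw.mono fun i hi => hi.const_mul _
  have hsq := tendsto_integral_sq_of_tendsto_sq haw hη h
  have ha0 := ha.eventually_gt_atTop 0
  have hmix : Tendsto (fun i => ∫ z, (u * (a i * w i z) + S z) ^ 2 ∂μ) l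
      (𝓝 (∫ z, (u * η z + S z) ^ 2 ∂μ)) := by
    refine tendsto_integral_sq_of_tendsto_sq (haw.mono fun i hi => (hi.const_mul u).add hS)
      ((hη.const_mul u).add hS) ?_
    have := h.const_mul (u ^ 2)
    rw [mul_zero] at this
    refine this.congr fun i => ?_
    rw [← integral_const_mul]
    exact integral_congr_ae (ae_of_all _ fun z => by simp only; ring)
  have hreal : Tendsto (fun i => ((u * (a i ^ 2 * ∫ z, w i z ∂μ) -
      u / 4 * ∫ z, (a i * w i z) ^ 2 ∂μ : ℝ) : ℂ) * Complex.I -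
        ((∫ z, (u * (a i * w i z) + S z) ^ 2 ∂μ) / 2 : ℝ)) l
      (𝓝 ((u * β - u / 4 * ∫ z, η z ^ 2 ∂μ : ℝ) * Complex.I -
        ((∫ z, (u * η z + S z) ^ 2 ∂μ) / 2 : ℝ))) := by
    refine Tendsto.sub (Tendsto.mul_const _ ?_) ?_
    · exact (Complex.continuous_ofReal.tendsto _).comp
        ((hβ.const_mul u).sub (hsq.const_mul (u / 4)))
    · exact (Complex.continuous_ofReal.tendsto _).comp (hmix.div_const 2)
  have hsum := hreal.add (tendsto_integral_expRemainder u ha hwm hSm hw hη hS h)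
  rw [add_zero] at hsum
  refine hsum.congr' ?_
  filter_upwards [hw, hwm, ha0, haw] with i hwi hwmi hai hawi
  have hs : MemLp (fun z => S z / a i) 2 μ := by
    simpa [div_eq_inv_mul] using hS.const_mul (a i)⁻¹
  have hsm : Measurable fun z => S z / a i := hSm.div_const _
  have hint := integrable_expRemainder (μ := μ) u hwmi hsm hwi hs
  set P : Ω → ℝ := fun z => u * w i z + S z / a i with hP
  set Q : Ω → ℝ := fun z => u / 4 * w i z ^ 2 with hQ
  have hPL : MemLp P 2 μ := (hwi.const_mul u).add hs
  have hPi : Integrable P μ := hPL.integrable (by norm_num)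
  have hQi : Integrable Q μ := hwi.integrable_sq.const_mul _
  -- An exact identity: the definition of the remainder solved for the exponential, so that each
  -- term can be integrated separately.
  have e1 : ∀ z, Complex.exp ((2 * u * Real.log (1 + w i z / 2) + S z / a i : ℝ) * Complex.I) =
      ((expRemainder u (w i z) (S z / a i) + 1) + ((P z - Q z : ℝ) : ℂ) * Complex.I) -
        ((P z ^ 2 / 2 : ℝ) : ℂ) := fun z => by
    simp only [expRemainder, hP, hQ]
    push_cast
    ring
  have i1 : Integrable (fun z => expRemainder u (w i z) (S z / a i) + 1) μ :=
    hint.add (integrable_const _)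
  have i2 : Integrable (fun z => ((P z - Q z : ℝ) : ℂ) * Complex.I) μ :=
    ((hPi.sub hQi).ofReal).mul_const _
  have i3 : Integrable (fun z => ((P z ^ 2 / 2 : ℝ) : ℂ)) μ := (hPL.integrable_sq.div_const 2).ofReal
  have i12 : Integrable (fun z => (expRemainder u (w i z) (S z / a i) + 1) +
      ((P z - Q z : ℝ) : ℂ) * Complex.I) μ := i1.add i2
  have hPint : ∫ z, P z ∂μ = u * ∫ z, w i z ∂μ := by
    rw [hP, integral_add ((hwi.integrable (by norm_num)).const_mul u)
      (hs.integrable (by norm_num)), integral_const_mul, integral_div, hS0, zero_div, add_zero]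
  have hQint : a i ^ 2 * ∫ z, Q z ∂μ = u / 4 * ∫ z, (a i * w i z) ^ 2 ∂μ := by
    simp only [hQ, mul_pow]
    rw [integral_const_mul, integral_const_mul]
    ring
  have hP2 : a i ^ 2 * ∫ z, P z ^ 2 ∂μ = ∫ z, (u * (a i * w i z) + S z) ^ 2 ∂μ := by
    rw [← integral_const_mul]
    refine integral_congr_ae (ae_of_all _ fun z => ?_)
    simp only [hP]
    field_simp
  rw [integral_congr_ae (ae_of_all _ e1), integral_sub i12 i3, integral_add i1 i2,
    integral_add hint (integrable_const _), integral_mul_const, integral_complex_ofReal,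
    integral_complex_ofReal,
    integral_const, probReal_univ, one_smul, integral_sub hPi hQi, integral_div, hPint, ← hP2,
    ← hQint]
  push_cast
  ring

end SquareIntegrable

/-! ### Consequences of differentiability in quadratic mean -/

namespace ArmModel

variable (M : ArmModel K p)

/-- Twice the increment of the square root of the likelihood ratio at `θ` in direction `ω`. -/
def rootIncrement (k : Fin K) (θ ω : Param p) (z : ℝ) : ℝ :=
  2 * (Real.sqrt (M.f k (θ + ω) z) / Real.sqrt (M.f k θ z) - 1)

variable {M}
variable {k : Fin K} {θ : Param p} {ℓ : ℝ → Param p}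

lemma measurable_rootIncrement (hθ : θ ∈ M.Θ) {ω : Param p} (hω : θ + ω ∈ M.Θ) :
    Measurable (M.rootIncrement k θ ω) := by
  have h := M.measurable_f k θ hθ
  have h' := M.measurable_f k _ hω
  unfold rootIncrement
  fun_prop

lemma sq_one_add_half_rootIncrement (hθ : θ ∈ M.Θ) {ω : Param p} (hω : θ + ω ∈ M.Θ) (z : ℝ) :
    (1 + M.rootIncrement k θ ω z / 2) ^ 2 = M.f k (θ + ω) z / M.f k θ z := by
  rw [rootIncrement, show 1 + 2 * (Real.sqrt (M.f k (θ + ω) z) / Real.sqrt (M.f k θ z) - 1) / 2 =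
    Real.sqrt (M.f k (θ + ω) z) / Real.sqrt (M.f k θ z) by ring, div_pow,
    Real.sq_sqrt (M.f_pos k _ hω z).le, Real.sq_sqrt (M.f_pos k _ hθ z).le]

lemma two_mul_log_rootIncrement (hθ : θ ∈ M.Θ) {ω : Param p} (hω : θ + ω ∈ M.Θ) (z : ℝ) :
    2 * Real.log (1 + M.rootIncrement k θ ω z / 2) = Real.log (M.f k (θ + ω) z / M.f k θ z) := by
  rw [← sq_one_add_half_rootIncrement hθ hω, Real.log_pow]
  norm_num

lemma lintegral_likelihoodRatio (hθ : θ ∈ M.Θ) {θ' : Param p} (hθ' : θ' ∈ M.Θ) :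
    ∫⁻ z, ENNReal.ofReal (M.f k θ' z / M.f k θ z) ∂(M.law k θ) = 1 := by
  have h : M.law k θ' Set.univ = 1 := measure_univ
  rwa [M.law_eq_withDensity hθ hθ', withDensity_apply _ MeasurableSet.univ,
    Measure.restrict_univ] at h

lemma integrable_ratio (hθ : θ ∈ M.Θ) {θ' : Param p} (hθ' : θ' ∈ M.Θ) :
    Integrable (fun z => M.f k θ' z / M.f k θ z) (M.law k θ) := by
  refine ⟨((M.measurable_f k θ' hθ').div (M.measurable_f k θ hθ)).aestronglyMeasurable, ?_⟩
  rw [hasFiniteIntegral_iff_ofReal (ae_of_all _ fun z =>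
    (div_pos (M.f_pos k _ hθ' z) (M.f_pos k _ hθ z)).le), lintegral_likelihoodRatio hθ hθ']
  exact ENNReal.one_lt_top

lemma integral_ratio (hθ : θ ∈ M.Θ) {θ' : Param p} (hθ' : θ' ∈ M.Θ) :
    ∫ z, M.f k θ' z / M.f k θ z ∂(M.law k θ) = 1 := by
  rw [integral_eq_lintegral_of_nonneg_ae (ae_of_all _ fun z =>
    (div_pos (M.f_pos k _ hθ' z) (M.f_pos k _ hθ z)).le)
    ((M.measurable_f k θ' hθ').div (M.measurable_f k θ hθ)).aestronglyMeasurable,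
    lintegral_likelihoodRatio hθ hθ', ENNReal.toReal_one]

/-- The square of 1 + w/2 is the density ratio, which is integrable. No differentiability is needed.
-/
lemma memLp_rootIncrement (hθ : θ ∈ M.Θ) {ω : Param p} (hω : θ + ω ∈ M.Θ) :
    MemLp (M.rootIncrement k θ ω) 2 (M.law k θ) := by
  have hm := measurable_rootIncrement (k := k) hθ hω
  have h : MemLp (fun z => 1 + M.rootIncrement k θ ω z / 2) 2 (M.law k θ) := by
    rw [memLp_two_iff_integrable_sq (by fun_prop)]
    simp_rw [sq_one_add_half_rootIncrement hθ hω]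
    exact integrable_ratio hθ hω
  refine ((h.sub (memLp_const 1)).const_mul 2).congr_norm hm.aestronglyMeasurable
    (ae_of_all _ fun z => ?_)
  simp only [Pi.sub_apply]
  congr 1
  ring

/-- Expand (1 + w/2)² = ratio and integrate: both sides have mean one. This turns the second moment
of w into its mean, which is of the order a⁻² that L² convergence of a w alone does not give. -/
lemma integral_rootIncrement (hθ : θ ∈ M.Θ) {ω : Param p} (hω : θ + ω ∈ M.Θ) :
    ∫ z, M.rootIncrement k θ ω z ∂(M.law k θ) =
      -(1 / 4) * ∫ z, M.rootIncrement k θ ω z ^ 2 ∂(M.law k θ) := by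
  have hL := memLp_rootIncrement (k := k) hθ hω
  have e : ∀ z, M.rootIncrement k θ ω z = (M.f k (θ + ω) z / M.f k θ z - 1) -
      1 / 4 * M.rootIncrement k θ ω z ^ 2 := fun z => by
    rw [← sq_one_add_half_rootIncrement hθ hω]
    ring
  have h1 := integrable_ratio (k := k) hθ hω
  have h2 : Integrable (fun z => M.f k (θ + ω) z / M.f k θ z - 1) (M.law k θ) :=
    h1.sub (integrable_const _)
  rw [integral_congr_ae (ae_of_all _ e), integral_sub h2 (hL.integrable_sq.const_mul _),
    integral_sub h1 (integrable_const _), integral_ratio hθ hω, integral_const, probReal_univ,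
    integral_const_mul]
  simp

lemma eventually_add_mem (hθ : θ ∈ M.Θ) : ∀ᶠ ω in 𝓝 (0 : Param p), θ + ω ∈ M.Θ := by
  have hc : Tendsto (fun ω => θ + ω) (𝓝 (0 : Param p)) (𝓝 θ) := by
    have : Continuous fun ω : Param p => θ + ω := by fun_prop
    simpa using this.tendsto 0
  exact hc.eventually (M.isOpen_Θ.mem_nhds hθ)

namespace IsDQM

lemma memLp_inner (hd : M.IsDQM k θ ℓ) (v : Param p) :
    MemLp (fun z => inner ℝ (ℓ z) v) 2 (M.law k θ) :=
  hd.memLp.inner_const v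

lemma measurable_inner (hd : M.IsDQM k θ ℓ) (v : Param p) :
    Measurable fun z => inner ℝ (ℓ z) v :=
  hd.measurable.inner_const

variable {ι : Type*} {l : Filter ι} {a : ι → ℝ} {ω : ι → Param p} {v : Param p}

lemma _root_.Bandit.tendsto_zero_of_tendsto_smul (ha : Tendsto a l atTop)
    (hω : Tendsto (fun i => a i • ω i) l (𝓝 v)) : Tendsto ω l (𝓝 0) := by
  have h := (tendsto_inv_atTop_zero.comp ha).smul hω
  rw [zero_smul] at h
  refine h.congr' ?_
  filter_upwards [ha.eventually_ne_atTop 0] with i hi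
  simp [smul_smul, inv_mul_cancel₀ hi]

/-- The remainder is o(‖ω‖²) and a²‖ω‖² stays bounded; replacing aω by its limit v costs at most ‖aω
- v‖² E‖ℓ‖². -/
lemma tendsto_integral_sq_sub (hθ : θ ∈ M.Θ) (hd : M.IsDQM k θ ℓ) (ha : Tendsto a l atTop)
    (hω : Tendsto (fun i => a i • ω i) l (𝓝 v)) :
    Tendsto (fun i => ∫ z, (a i * M.rootIncrement k θ (ω i) z - inner ℝ (ℓ z) v) ^ 2
      ∂(M.law k θ)) l (𝓝 0) := by
  have hω0 := tendsto_zero_of_tendsto_smul ha hω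
  set r : Param p → ℝ := fun ω => ∫ z, (M.rootIncrement k θ ω z - inner ℝ (ℓ z) ω) ^ 2
    ∂(M.law k θ) with hr
  have hro : r =o[𝓝 0] fun ω => ‖ω‖ ^ 2 := hd.remainder
  have h1 : Tendsto (fun i => a i ^ 2 * r (ω i)) l (𝓝 0) := by
    have h := (isBigO_refl (fun i => a i ^ 2) l).mul_isLittleO (hro.comp_tendsto hω0)
    refine (isLittleO_one_iff ℝ).mp (h.trans_isBigO ?_)
    refine ((hω.norm.pow 2).isBigO_one ℝ).congr_left fun i => ?_
    rw [norm_smul, mul_pow, Real.norm_eq_abs, sq_abs]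
    rfl
  have h2 : Tendsto (fun i => ‖a i • ω i - v‖ ^ 2 * ∫ z, ‖ℓ z‖ ^ 2 ∂(M.law k θ)) l (𝓝 0) := by
    have := ((tendsto_iff_norm_sub_tendsto_zero.mp hω).pow 2).mul_const
      (∫ z, ‖ℓ z‖ ^ 2 ∂(M.law k θ))
    simpa using this
  have hub := (h1.const_mul 2).add (h2.const_mul 2)
  rw [mul_zero, add_zero] at hub
  refine squeeze_zero' (Eventually.of_forall fun i => integral_nonneg fun z => sq_nonneg _) ?_ hub
  filter_upwards [hω0.eventually (eventually_add_mem hθ)] with i hi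
  have hw := memLp_rootIncrement (k := k) hθ hi
  have i1 : Integrable (fun z => (M.rootIncrement k θ (ω i) z - inner ℝ (ℓ z) (ω i)) ^ 2)
      (M.law k θ) := (hw.sub (hd.memLp_inner _)).integrable_sq
  have i2 : Integrable (fun z => ‖ℓ z‖ ^ 2) (M.law k θ) := hd.memLp.norm.integrable_sq
  have i3 : Integrable (fun z => (a i * M.rootIncrement k θ (ω i) z - inner ℝ (ℓ z) v) ^ 2)
      (M.law k θ) := ((hw.const_mul (a i)).sub (hd.memLp_inner v)).integrable_sq
  calc ∫ z, (a i * M.rootIncrement k θ (ω i) z - inner ℝ (ℓ z) v) ^ 2 ∂(M.law k θ)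
      ≤ ∫ z, 2 * (a i ^ 2 * (M.rootIncrement k θ (ω i) z - inner ℝ (ℓ z) (ω i)) ^ 2) +
          2 * (‖a i • ω i - v‖ ^ 2 * ‖ℓ z‖ ^ 2) ∂(M.law k θ) := by
        refine integral_mono i3 (((i1.const_mul _).const_mul 2).add
          ((i2.const_mul _).const_mul 2)) fun z => ?_
        have e : a i * M.rootIncrement k θ (ω i) z - inner ℝ (ℓ z) v =
            a i * (M.rootIncrement k θ (ω i) z - inner ℝ (ℓ z) (ω i)) +
              inner ℝ (ℓ z) (a i • ω i - v) := by
          rw [inner_sub_right, real_inner_smul_right]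
          ring
        have hcs : (inner ℝ (ℓ z) (a i • ω i - v)) ^ 2 ≤ ‖a i • ω i - v‖ ^ 2 * ‖ℓ z‖ ^ 2 := by
          have := abs_real_inner_le_norm (ℓ z) (a i • ω i - v)
          rw [← mul_pow, mul_comm, ← sq_abs]
          exact pow_le_pow_left₀ (abs_nonneg _) this 2
        simp only [e]
        nlinarith [sq_nonneg (a i * (M.rootIncrement k θ (ω i) z - inner ℝ (ℓ z) (ω i)) -
          inner ℝ (ℓ z) (a i • ω i - v))]
    _ = 2 * (a i ^ 2 * r (ω i)) +
          2 * (‖a i • ω i - v‖ ^ 2 * ∫ z, ‖ℓ z‖ ^ 2 ∂(M.law k θ)) := by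
        rw [integral_add ((i1.const_mul _).const_mul 2) ((i2.const_mul _).const_mul 2),
          integral_const_mul, integral_const_mul, integral_const_mul, integral_const_mul]

lemma tendsto_integral_sq (hθ : θ ∈ M.Θ) (hd : M.IsDQM k θ ℓ) (ha : Tendsto a l atTop)
    (hω : Tendsto (fun i => a i • ω i) l (𝓝 v)) :
    Tendsto (fun i => a i ^ 2 * ∫ z, M.rootIncrement k θ (ω i) z ∂(M.law k θ)) l
      (𝓝 (-(1 / 4) * ∫ z, (inner ℝ (ℓ z) v) ^ 2 ∂(M.law k θ))) := by
  have hmem := (tendsto_zero_of_tendsto_smul ha hω).eventually (eventually_add_mem hθ)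
  have h := (tendsto_integral_sq_of_tendsto_sq (hmem.mono fun i hi =>
    (memLp_rootIncrement (k := k) hθ hi).const_mul (a i)) (hd.memLp_inner v)
    (hd.tendsto_integral_sq_sub hθ ha hω)).const_mul (-(1 / 4))
  refine h.congr' ?_
  filter_upwards [hmem] with i hi
  rw [integral_rootIncrement hθ hi]
  simp_rw [mul_pow]
  rw [integral_const_mul]
  ring

/-- Along ω = v/n, n E w tends to E ℓ'v by L² convergence, yet n² E w converges, so n E w → 0. -/
lemma integral_inner (hθ : θ ∈ M.Θ) (hd : M.IsDQM k θ ℓ) (v : Param p) :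
    ∫ z, inner ℝ (ℓ z) v ∂(M.law k θ) = 0 := by
  have ha : Tendsto (fun n : ℕ => (n : ℝ)) atTop atTop := tendsto_natCast_atTop_atTop
  have hω : Tendsto (fun n : ℕ => (n : ℝ) • ((n : ℝ)⁻¹ • v)) atTop (𝓝 v) := by
    refine tendsto_const_nhds.congr' ?_
    filter_upwards [ha.eventually_ne_atTop 0] with n hn
    rw [smul_smul, mul_inv_cancel₀ hn, one_smul]
  have hmem := (tendsto_zero_of_tendsto_smul ha hω).eventually (eventually_add_mem hθ)
  have h1 := tendsto_integral_mul_of_tendsto_sq (Y := fun _ => 1) (hmem.mono fun n hn =>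
    (memLp_rootIncrement (k := k) hθ hn).const_mul (n : ℝ)) (hd.memLp_inner v) (memLp_const 1)
    (hd.tendsto_integral_sq_sub hθ ha hω)
  have h2 := (tendsto_inv_atTop_zero.comp ha).mul (hd.tendsto_integral_sq hθ ha hω)
  rw [zero_mul] at h2
  simp only [mul_one] at h1
  refine tendsto_nhds_unique (h1.congr' ?_) h2
  filter_upwards [ha.eventually_ne_atTop 0] with n hn
  rw [integral_const_mul, Function.comp_apply]
  field_simp

/-- Second order expansion of the characteristic function of the normalized score. -/
lemma tendsto_score (hθ : θ ∈ M.Θ) (hd : M.IsDQM k θ ℓ) (ha : Tendsto a l atTop) (v : Param p) :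
    Tendsto (fun i => ((a i ^ 2 : ℝ) : ℂ) * ((∫ z, Complex.exp
        ((inner ℝ (ℓ z) v / a i : ℝ) * Complex.I) ∂(M.law k θ)) - 1)) l
      (𝓝 ((-((∫ z, (inner ℝ (ℓ z) v) ^ 2 ∂(M.law k θ)) / 2) : ℝ) : ℂ)) := by
  -- With u = 0 the likelihood part disappears and only the score term S/a remains.
  have h := tendsto_mul_integral_exp_sub_one (μ := M.law k θ) (u := 0) (β := 0) ha
    (w := fun _ _ => 0) (η := fun _ => 0) (Eventually.of_forall fun _ => measurable_const)
    (hd.measurable_inner v) (Eventually.of_forall fun _ => memLp_const 0) (memLp_const 0)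
    (hd.memLp_inner v) (by simp [tendsto_const_nhds]) (by simp [tendsto_const_nhds])
    (hd.integral_inner hθ v)
  simpa using h

/-- Second order expansion of the characteristic function of the remainder in the linearization of
the log-likelihood ratio. -/
lemma tendsto_logLikelihood (hθ : θ ∈ M.Θ) (hd : M.IsDQM k θ ℓ) (ha : Tendsto a l atTop)
    (hω : Tendsto (fun i => a i • ω i) l (𝓝 v)) (u : ℝ) :
    Tendsto (fun i => ((a i ^ 2 : ℝ) : ℂ) * ((∫ z, Complex.exp
        ((u * (Real.log (M.f k (θ + ω i) z / M.f k θ z) - inner ℝ (ℓ z) v / a i) : ℝ) * Complex.I)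
          ∂(M.law k θ)) - 1)) l
      (𝓝 ((-(u * (∫ z, (inner ℝ (ℓ z) v) ^ 2 ∂(M.law k θ)) / 2) : ℝ) * Complex.I)) := by
  have hmem := (tendsto_zero_of_tendsto_smul ha hω).eventually (eventually_add_mem hθ)
  -- Taking S = -u ℓ'v cancels uη in the variance term. The drift is left: -u/4 from the mean of w
  -- and -u/4 from the curvature of the logarithm, times E(ℓ'v)².
  have h := tendsto_mul_integral_exp_sub_one (μ := M.law k θ) u ha
    (w := fun i => M.rootIncrement k θ (ω i)) (S := fun z => -u * inner ℝ (ℓ z) v)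
    (hmem.mono fun i hi => measurable_rootIncrement hθ hi)
    ((hd.measurable_inner v).const_mul _) (hmem.mono fun i hi => memLp_rootIncrement hθ hi)
    (hd.memLp_inner v) ((hd.memLp_inner v).const_mul _) (hd.tendsto_integral_sq_sub hθ ha hω)
    (hd.tendsto_integral_sq hθ ha hω) (by rw [integral_const_mul, hd.integral_inner hθ, mul_zero])
  have e : ((u * (-(1 / 4) * ∫ z, (inner ℝ (ℓ z) v) ^ 2 ∂(M.law k θ)) -
      u / 4 * ∫ z, (inner ℝ (ℓ z) v) ^ 2 ∂(M.law k θ) : ℝ) : ℂ) * Complex.I -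
      ((∫ z, (u * inner ℝ (ℓ z) v + -u * inner ℝ (ℓ z) v) ^ 2 ∂(M.law k θ)) / 2 : ℝ) =
      (-(u * (∫ z, (inner ℝ (ℓ z) v) ^ 2 ∂(M.law k θ)) / 2) : ℝ) * Complex.I := by
    have : ∀ z, (u * inner ℝ (ℓ z) v + -u * inner ℝ (ℓ z) v) ^ 2 = 0 := fun z => by ring
    simp only [this, integral_zero]
    push_cast
    ring
  rw [e] at h
  refine h.congr' ?_
  filter_upwards [hmem] with i hi
  congr 2
  refine integral_congr_ae (ae_of_all _ fun z => ?_)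
  simp only [← two_mul_log_rootIncrement hθ hi]
  congr 3
  ring

end IsDQM

end ArmModel

/-! ### From characteristic functions to convergence -/

section CharacteristicFunctions

variable {Ω : ℕ → Type*} [∀ T, MeasurableSpace (Ω T)] {P : (T : ℕ) → Measure (Ω T)}
  [∀ T, IsProbabilityMeasure (P T)]

/-- The probability of a large value is bounded by the integral of 1 - charFun over a compact
interval, where dominated convergence applies with bound 2. Measurability is only asked eventually,
since the localized parameter may leave Θ for small T. -/
lemma tendstoInProbability_zero_of_tendsto_integral_exp {X : (T : ℕ) → Ω T → ℝ}
    (hX : ∀ᶠ T in atTop, AEMeasurable (X T) (P T))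
    (h : ∀ u : ℝ, Tendsto (fun T => ∫ x, Complex.exp ((u * X T x : ℝ) * Complex.I) ∂(P T)) atTop
      (𝓝 1)) :
    TendstoInProbability P X 0 := by
  intro ε hε
  have hchar : ∀ u : ℝ, Tendsto (fun T => 1 - charFun ((P T).map (X T)) u) atTop (𝓝 0) := by
    intro u
    have := (h u).const_sub 1
    rw [sub_self] at this
    refine this.congr' ?_
    filter_upwards [hX] with T hT
    rw [charFun_apply_real, integral_map hT (by fun_prop)]
    simp
  have hint : Tendsto (fun T => ∫ t in (-2 * (ε / 2)⁻¹)..(2 * (ε / 2)⁻¹),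
      1 - charFun ((P T).map (X T)) t) atTop (𝓝 (∫ _ in (-2 * (ε / 2)⁻¹)..(2 * (ε / 2)⁻¹), 0)) := by
    refine intervalIntegral.tendsto_integral_filter_of_dominated_convergence (fun _ => 2) ?_ ?_
      (by simp) (ae_of_all _ fun u _ => hchar u)
    · filter_upwards with T
      exact (measurable_const.sub measurable_charFun).aestronglyMeasurable
    · filter_upwards [hX] with T hT
      refine ae_of_all _ fun u _ => ?_
      have := Measure.isProbabilityMeasure_map hT
      exact norm_one_sub_charFun_le_two
  have hb := ((hint.norm.const_mul (2⁻¹ * (ε / 2))))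
  rw [intervalIntegral.integral_zero, norm_zero, mul_zero] at hb
  have hb' := ENNReal.tendsto_ofReal hb
  rw [ENNReal.ofReal_zero] at hb'
  refine tendsto_of_tendsto_of_tendsto_of_le_of_le' tendsto_const_nhds hb'
    (Eventually.of_forall fun _ => zero_le) ?_
  filter_upwards [hX] with T hT
  have := Measure.isProbabilityMeasure_map hT
  -- The tail bound is for a strict inequality, hence the level ε/2 to cover {ε ≤ |X|}.
  have hle := measureReal_abs_gt_le_integral_charFun (μ := (P T).map (X T)) (half_pos hε)
  refine le_trans ?_ (ENNReal.ofReal_le_ofReal hle)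
  rw [ofReal_measureReal, Measure.map_apply_of_aemeasurable hT
    (measurableSet_lt measurable_const continuous_abs.measurable)]
  refine measure_mono fun x hx => ?_
  simp only [sub_zero, Set.mem_ofPred_eq] at hx
  simp only [Set.mem_preimage, Set.mem_ofPred_eq]
  linarith

lemma tendstoInDistribution_multivariateGaussian {ι : Type*} [Fintype ι] [DecidableEq ι]
    {S : Matrix ι ι ℝ} (hS : S.PosSemidef) {X : (T : ℕ) → Ω T → EuclideanSpace ℝ ι}
    (hX : ∀ T, Measurable (X T))
    (h : ∀ u : EuclideanSpace ℝ ι, Tendsto (fun T => ∫ x, Complex.exp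
      ((inner ℝ (X T x) u : ℝ) * Complex.I) ∂(P T)) atTop
        (𝓝 (Complex.exp ((-((u.ofLp ⬝ᵥ S.mulVec u.ofLp) / 2) : ℝ) : ℂ)))) :
    TendstoInDistribution X atTop id P (multivariateGaussian 0 S) where
  forall_aemeasurable T := (hX T).aemeasurable
  aemeasurable_limit := aemeasurable_id
  tendsto := by
    refine ProbabilityMeasure.tendsto_of_tendsto_charFun fun u => ?_
    have e : Complex.exp ((-((u.ofLp ⬝ᵥ S.mulVec u.ofLp) / 2) : ℝ) : ℂ) =
        charFun ((multivariateGaussian 0 S).map id) u := by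
      rw [Measure.map_id, charFun_multivariateGaussian hS]
      simp
    have h' := h u
    rw [e] at h'
    refine h'.congr fun T => ?_
    exact (integral_map (f := fun y => Complex.exp ((inner ℝ y u : ℝ) * Complex.I))
      (hX T).aemeasurable (by fun_prop)).symm

end CharacteristicFunctions

/-! ### Information matrices and masked directions -/

namespace ArmModel

variable (M : ArmModel K p) (θ : Param p) (ℓ : Fin K → ℝ → Param p)

lemma inner_eq_dotProduct (x v : Param p) : inner ℝ x v = ∑ j, v j * x j := by
  simp [PiLp.inner_apply]

variable {M θ ℓ} in
lemma dotProduct_fisher_mulVec {k : Fin K} (hd : M.IsDQM k θ (ℓ k)) (v : Param p) :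
    v.ofLp ⬝ᵥ (M.fisher θ ℓ k).mulVec v.ofLp =
      ∫ z, (inner ℝ (ℓ k z) v) ^ 2 ∂(M.law k θ) := by
  have hj : ∀ j, MemLp (fun z => ℓ k z j) 2 (M.law k θ) := fun j => by
    have := hd.memLp_inner (EuclideanSpace.single j 1)
    simpa [inner_eq_dotProduct] using this
  have hij : ∀ i j, Integrable (fun z => ℓ k z i * ℓ k z j) (M.law k θ) := fun i j =>
    (hj i).integrable_mul (hj j)
  have e : ∀ z, (inner ℝ (ℓ k z) v) ^ 2 =
      ∑ i, ∑ j, v i * (ℓ k z i * ℓ k z j * v j) := fun z => by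
    rw [inner_eq_dotProduct, pow_two, Finset.sum_mul_sum]
    exact Finset.sum_congr rfl fun i _ => Finset.sum_congr rfl fun j _ => by ring
  simp_rw [e]
  rw [integral_finsetSum _ fun i _ => integrable_finsetSum _ fun j _ =>
    ((hij i j).mul_const _).const_mul _]
  refine Finset.sum_congr rfl fun i _ => ?_
  rw [integral_finsetSum _ fun j _ => ((hij i j).mul_const _).const_mul _, Matrix.mulVec,
    dotProduct, Finset.mul_sum]
  refine Finset.sum_congr rfl fun j _ => ?_
  rw [integral_const_mul, integral_mul_const]
  rfl

lemma fisher_comm (k : Fin K) (i j : Fin p) : M.fisher θ ℓ k i j = M.fisher θ ℓ k j i := by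
  simp only [fisher, Matrix.of_apply, mul_comm]

variable {M θ ℓ} in
lemma posSemidef_fisher {k : Fin K} (hd : M.IsDQM k θ (ℓ k)) : (M.fisher θ ℓ k).PosSemidef := by
  refine Matrix.PosSemidef.of_dotProduct_mulVec_nonneg ?_ fun x => ?_
  · ext i j
    simp [M.fisher_comm θ ℓ k i j]
  · have := dotProduct_fisher_mulVec hd (WithLp.toLp 2 x)
    simp only [star_trivial]
    rw [this]
    exact integral_nonneg fun z => sq_nonneg _

/-- The indicator of the parameter components to which arm `k` contributes in the limit. -/
def mask (ks : Fin K) : Regime → Fin K → Fin p → ℝ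
  | .linear, _, _ => 1
  | .logarithmic, k, j => if k = ks ∨ M.fisher θ ℓ ks j j = 0 then 1 else 0

/-- The part of the direction `h` to which arm `k` contributes in the limit. -/
def maskedDir (ks : Fin K) (reg : Regime) (k : Fin K) (h : Param p) : Param p :=
  WithLp.toLp 2 fun j => M.mask θ ℓ ks reg k j * h j

variable {M θ ℓ} in
lemma fisher_eq_zero {k : Fin K} (hd : M.IsDQM k θ (ℓ k)) {j : Fin p}
    (hj : M.fisher θ ℓ k j j = 0) : ∀ᵐ z ∂(M.law k θ), ℓ k z j = 0 := by
  have h := hd.memLp_inner (EuclideanSpace.single j 1)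
  have h2 : Integrable (fun z => ℓ k z j * ℓ k z j) (M.law k θ) := by
    have := h.integrable_sq
    simpa [inner_eq_dotProduct, pow_two] using this
  rw [fisher, Matrix.of_apply, integral_eq_zero_iff_of_nonneg (fun z => mul_self_nonneg _) h2] at hj
  filter_upwards [hj] with z hz
  simpa using hz

/-- As a combination of congruences D J_k D with diagonal masks D, the limit information is visibly
positive semidefinite for C_k ≥ 0, and its quadratic form at h is that of J_k at the masked
directions. -/
lemma limitInfo_eq (ks : Fin K) {C : Fin K → ℝ} {reg : Regime}
    (hC : reg = .logarithmic → C ks = 1) :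
    M.limitInfo θ ℓ ks C reg = ∑ k, C k • (Matrix.diagonal (M.mask θ ℓ ks reg k) *
      M.fisher θ ℓ k * Matrix.diagonal (M.mask θ ℓ ks reg k)) := by
  ext i j
  rw [Matrix.sum_apply]
  simp only [Matrix.smul_apply, Matrix.mul_diagonal, Matrix.diagonal_mul, smul_eq_mul]
  cases reg with
  | linear => simp [limitInfo, mask, Matrix.sum_apply]
  | logarithmic =>
    rw [← Finset.add_sum_erase _ _ (Finset.mem_univ ks)]
    simp only [limitInfo, mask, Matrix.of_apply, hC rfl, true_or, if_true, one_mul, mul_one]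
    congr 1
    split_ifs with h
    · refine Finset.sum_congr rfl fun k hk => ?_
      simp [h.1, h.2]
    · refine (Finset.sum_eq_zero fun k hk => ?_).symm
      have hk' := Finset.ne_of_mem_erase hk
      rw [not_and_or] at h
      rcases h with h | h <;> simp [h, hk']

lemma diagonal_mask_mulVec (ks : Fin K) (reg : Regime) (k : Fin K) (h : Param p) :
    (Matrix.diagonal (M.mask θ ℓ ks reg k)).mulVec h.ofLp =
      (M.maskedDir θ ℓ ks reg k h).ofLp := by
  ext j
  simp [maskedDir, Matrix.mulVec_diagonal]

variable {M θ ℓ} in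
lemma dotProduct_limitInfo_mulVec (hd : ∀ k, M.IsDQM k θ (ℓ k)) (ks : Fin K) {C : Fin K → ℝ}
    {reg : Regime} (hC : reg = .logarithmic → C ks = 1) (h : Param p) :
    h.ofLp ⬝ᵥ (M.limitInfo θ ℓ ks C reg).mulVec h.ofLp = ∑ k, C k *
      ∫ z, (inner ℝ (ℓ k z) (M.maskedDir θ ℓ ks reg k h)) ^ 2 ∂(M.law k θ) := by
  rw [M.limitInfo_eq θ ℓ ks hC, Matrix.sum_mulVec, dotProduct_sum]
  refine Finset.sum_congr rfl fun k _ => ?_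
  rw [← dotProduct_fisher_mulVec (hd k), Matrix.smul_mulVec, dotProduct_smul, smul_eq_mul,
    ← Matrix.mulVec_mulVec, ← Matrix.mulVec_mulVec,
    Matrix.dotProduct_mulVec h.ofLp (Matrix.diagonal _), ← Matrix.mulVec_transpose,
    Matrix.diagonal_transpose, diagonal_mask_mulVec]

variable {M θ ℓ} in
lemma posSemidef_limitInfo (hd : ∀ k, M.IsDQM k θ (ℓ k)) (ks : Fin K) {C : Fin K → ℝ}
    {reg : Regime} (hC : reg = .logarithmic → C ks = 1) (hC0 : ∀ k, 0 ≤ C k) :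
    (M.limitInfo θ ℓ ks C reg).PosSemidef := by
  rw [M.limitInfo_eq θ ℓ ks hC]
  refine Matrix.posSemidef_sum _ fun k _ => Matrix.PosSemidef.smul ?_ (hC0 k)
  have := (posSemidef_fisher (hd k)).conjTranspose_mul_mul_same
    (Matrix.diagonal (M.mask θ ℓ ks reg k))
  simpa [Matrix.diagonal_conjTranspose] using this

/-- The component of arm `k` in a vector of length `K p`. -/
def _root_.Bandit.armPart (k : Fin K) (u : EuclideanSpace ℝ (Fin p × Fin K)) : Param p :=
  WithLp.toLp 2 fun j => u (j, k)

variable {M θ ℓ} in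
lemma dotProduct_blockDiagonal_mulVec (hd : ∀ k, M.IsDQM k θ (ℓ k)) (C : Fin K → ℝ)
    (u : EuclideanSpace ℝ (Fin p × Fin K)) :
    u.ofLp ⬝ᵥ (Matrix.blockDiagonal fun k => C k • M.fisher θ ℓ k).mulVec u.ofLp =
      ∑ k, C k * ∫ z, (inner ℝ (ℓ k z) (armPart k u)) ^ 2 ∂(M.law k θ) := by
  simp_rw [← fun k => dotProduct_fisher_mulVec (hd k) (armPart k u)]
  simp only [dotProduct, Matrix.mulVec, Fintype.sum_prod_type_right, Matrix.blockDiagonal_apply,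
    Finset.mul_sum, armPart]
  refine Finset.sum_congr rfl fun k _ => Finset.sum_congr rfl fun i _ => ?_
  rw [Finset.sum_eq_single k]
  · refine Finset.sum_congr rfl fun j _ => ?_
    simp only [if_true, Matrix.smul_apply, smul_eq_mul]
    ring
  · intro b _ hb
    simp [hb.symm]
  · simp

variable {M θ ℓ} in
lemma posSemidef_blockDiagonal (hd : ∀ k, M.IsDQM k θ (ℓ k)) {C : Fin K → ℝ}
    (hC0 : ∀ k, 0 ≤ C k) :
    (Matrix.blockDiagonal fun k => C k • M.fisher θ ℓ k).PosSemidef := by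
  refine Matrix.PosSemidef.of_dotProduct_mulVec_nonneg ?_ fun x => ?_
  · refine Matrix.isHermitian_blockDiagonal_iff.mpr fun k => ?_
    exact ((posSemidef_fisher (hd k)).smul (hC0 k)).isHermitian
  · have := dotProduct_blockDiagonal_mulVec hd C (WithLp.toLp 2 x)
    simp only [star_trivial]
    rw [this]
    exact Finset.sum_nonneg fun k _ => mul_nonneg (hC0 k) (integral_nonneg fun z => sq_nonneg _)

lemma inner_scoreSum (ks : Fin K) (reg : Regime) (k : Fin K) (T : ℕ) (x : Fin T → Fin K × ℝ)
    (v : Param p) : inner ℝ (scoreSum ℓ ks reg k T x) v =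
      ∑ t, if (x t).1 = k then inner ℝ (ℓ k (x t).2) v / armRate ks reg k T else 0 := by
  rw [scoreSum, real_inner_smul_left, sum_inner, Finset.mul_sum]
  refine Finset.sum_congr rfl fun t _ => ?_
  split_ifs
  · rw [div_eq_inv_mul]
  · simp

lemma sum_inner_scoreSum (ks : Fin K) (reg : Regime) (T : ℕ) (x : Fin T → Fin K × ℝ)
    (v : Fin K → Param p) : ∑ k, inner ℝ (scoreSum ℓ ks reg k T x) (v k) =
      ∑ t, inner ℝ (ℓ (x t).1 (x t).2) (v (x t).1) / armRate ks reg (x t).1 T := by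
  simp_rw [inner_scoreSum]
  rw [Finset.sum_comm]
  exact Finset.sum_congr rfl fun t _ => by simp

lemma inner_stackedScore (ks : Fin K) (reg : Regime) (T : ℕ) (x : Fin T → Fin K × ℝ)
    (u : EuclideanSpace ℝ (Fin p × Fin K)) : inner ℝ (stackedScore ℓ ks reg T x) u =
      ∑ t, inner ℝ (ℓ (x t).1 (x t).2) (armPart (x t).1 u) / armRate ks reg (x t).1 T := by
  rw [← sum_inner_scoreSum ℓ ks reg T x fun k => armPart k u]
  simp [PiLp.inner_apply, stackedScore, armPart, Fintype.sum_prod_type_right]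

/-- Moving the indicators from the central sequence onto h gives a single sum over time of
arm-dependent linear functions of the score, the form required by the limit theorem. -/
lemma inner_centralSeq (ks : Fin K) (reg : Regime) (T : ℕ) (x : Fin T → Fin K × ℝ)
    (h : Param p) : inner ℝ (M.centralSeq θ ℓ ks reg T x) h =
      ∑ t, inner ℝ (ℓ (x t).1 (x t).2) (M.maskedDir θ ℓ ks reg (x t).1 h) /
        armRate ks reg (x t).1 T := by
  rw [← sum_inner_scoreSum ℓ ks reg T x fun k => M.maskedDir θ ℓ ks reg k h]
  simp only [inner_eq_dotProduct]
  rw [Finset.sum_comm]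
  refine Finset.sum_congr rfl fun j _ => ?_
  cases reg with
  | linear => simp [centralSeq, maskedDir, mask, Finset.mul_sum]
  | logarithmic =>
    rw [← Finset.add_sum_erase _ _ (Finset.mem_univ ks)]
    simp only [centralSeq, maskedDir, mask, true_or, if_true, one_mul]
    rw [mul_add]
    congr 1
    split_ifs with hj
    · rw [Finset.mul_sum]
      refine Finset.sum_congr rfl fun k hk => ?_
      simp [hj]
    · rw [mul_zero]
      refine (Finset.sum_eq_zero fun k hk => ?_).symm
      simp [hj, Finset.ne_of_mem_erase hk]

end ArmModel

/-! ### Rates and numbers of pulls -/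

lemma Regime.size_nonneg (reg : Regime) (T : ℕ) : 0 ≤ reg.size T := by
  cases reg
  · exact Real.log_natCast_nonneg T
  · exact Nat.cast_nonneg T

lemma Regime.tendsto_size (reg : Regime) : Tendsto reg.size atTop atTop := by
  cases reg
  · exact Real.tendsto_log_atTop.comp tendsto_natCast_atTop_atTop
  · exact tendsto_natCast_atTop_atTop

lemma tendsto_sqrt_natCast : Tendsto (fun T : ℕ => Real.sqrt T) atTop atTop :=
  Real.tendsto_sqrt_atTop.comp tendsto_natCast_atTop_atTop

lemma Regime.tendsto_sqrt_size (reg : Regime) :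
    Tendsto (fun T => Real.sqrt (reg.size T)) atTop atTop :=
  Real.tendsto_sqrt_atTop.comp reg.tendsto_size

lemma tendsto_armRate (ks : Fin K) (reg : Regime) (k : Fin K) :
    Tendsto (armRate ks reg k) atTop atTop := by
  unfold armRate
  split_ifs
  · exact tendsto_sqrt_natCast
  · exact reg.tendsto_sqrt_size

lemma armRate_sq (ks : Fin K) (reg : Regime) (k : Fin K) (T : ℕ) :
    armRate ks reg k T ^ 2 = if k = ks then (T : ℝ) else reg.size T := by
  unfold armRate
  split_ifs
  · exact Real.sq_sqrt (Nat.cast_nonneg T)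
  · exact Real.sq_sqrt (reg.size_nonneg T)

lemma sum_pulls {T : ℕ} (x : Fin T → Fin K × ℝ) : ∑ k, pulls k x = T := by
  simp_rw [pulls_eq_sum]
  rw [Finset.sum_comm]
  simp

lemma tendsto_sqrt_log_div_sqrt :
    Tendsto (fun T : ℕ => Real.sqrt (Real.log T) / Real.sqrt T) atTop (𝓝 0) := by
  have h : Tendsto (fun T : ℕ => Real.log T / T) atTop (𝓝 0) :=
    Real.isLittleO_log_id_atTop.tendsto_div_nhds_zero.comp tendsto_natCast_atTop_atTop
  have := h.sqrt
  rw [Real.sqrt_zero] at this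
  exact this.congr fun T => Real.sqrt_div' _ (Nat.cast_nonneg T)

namespace ArmModel

variable {M : ArmModel K p} {θ : Param p} {ℓ : Fin K → ℝ → Param p} {pol : Policy K} {ks : Fin K}
  {C : Fin K → ℝ} {reg : Regime}

lemma SamplingAssumption.nonneg (h : M.SamplingAssumption pol θ ks C reg) (k : Fin K) :
    0 ≤ C k := by
  cases reg with
  | linear => exact (h k).1.1.le
  | logarithmic =>
    by_cases hk : k = ks
    · rw [hk, h.1]
      exact zero_le_one
    · exact (h.2 k hk).1.le

lemma SamplingAssumption.apply_eq_one (h : M.SamplingAssumption pol θ ks C reg)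
    (hreg : reg = .logarithmic) : C ks = 1 := by
  subst hreg
  exact h.1

/-- In the logarithmic regime, the optimal arm is pulled almost all the time. -/
lemma SamplingAssumption.pullRate_optimal
    (h : M.SamplingAssumption pol θ ks C .logarithmic) :
    M.PullRate pol θ ks (fun T => (T : ℝ)) 1 := by
  have hall : ∀ᵐ ω ∂(M.pathLaw pol θ), ∀ k, k ≠ ks →
      Tendsto (fun T : ℕ => (pulls k (truncate T ω) : ℝ) / Real.log T) atTop (𝓝 (C k)) :=
    ae_all_iff.mpr fun k => by
      by_cases hk : k = ks
      · exact ae_of_all _ fun ω hne => absurd hk hne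
      · filter_upwards [(h.2 k hk).2] with ω hω _ using hω
  unfold PullRate
  filter_upwards [hall] with ω hω
  have hlog : Tendsto (fun T : ℕ => Real.log T / T) atTop (𝓝 0) :=
    Real.isLittleO_log_id_atTop.tendsto_div_nhds_zero.comp tendsto_natCast_atTop_atTop
  -- The pull counts sum to T, and each suboptimal share is (D_k/log T)(log T/T) → 0.
  have h0 : Tendsto (fun T : ℕ => ∑ k ∈ Finset.univ.erase ks,
      (pulls k (truncate T ω) : ℝ) / Real.log T * (Real.log T / T)) atTop (𝓝 0) := by
    have := tendsto_finsetSum (Finset.univ.erase ks) fun k hk =>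
      (hω k (Finset.ne_of_mem_erase hk)).mul hlog
    simpa using this
  have h1 := h0.const_sub 1
  rw [sub_zero] at h1
  refine h1.congr' ?_
  filter_upwards [eventually_gt_atTop 1] with T hT
  have hT' : (1 : ℝ) < T := by exact_mod_cast hT
  have hT0 : (T : ℝ) ≠ 0 := by positivity
  have hlog0 : Real.log T ≠ 0 := (Real.log_pos hT').ne'
  have hs : (pulls ks (truncate T ω) : ℝ) +
      ∑ k ∈ Finset.univ.erase ks, (pulls k (truncate T ω) : ℝ) = T := by
    rw [Finset.add_sum_erase _ (fun k => (pulls k (truncate T ω) : ℝ)) (Finset.mem_univ ks)]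
    exact_mod_cast sum_pulls (truncate T ω)
  have e : ∑ k ∈ Finset.univ.erase ks, (pulls k (truncate T ω) : ℝ) / Real.log T *
      (Real.log T / T) = (∑ k ∈ Finset.univ.erase ks, (pulls k (truncate T ω) : ℝ)) / T := by
    rw [Finset.sum_div]
    exact Finset.sum_congr rfl fun k _ => by field_simp
  rw [e, eq_div_iff hT0, sub_mul, div_mul_cancel₀ _ hT0]
  linarith

/-- Brings both regimes to the common form D_k/a_k² → C_k. -/
lemma SamplingAssumption.pullRate (h : M.SamplingAssumption pol θ ks C reg) (k : Fin K) :
    M.PullRate pol θ k (fun T => armRate ks reg k T ^ 2) (C k) := by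
  simp_rw [armRate_sq]
  cases reg with
  | linear => simpa [Regime.size] using (h k).2
  | logarithmic =>
    by_cases hk : k = ks
    · subst hk
      simpa [h.1] using h.pullRate_optimal
    · simpa [hk, Regime.size] using (h.2 k hk).2

lemma normalizedInfo_apply (k : Fin K) (T : ℕ) (x : Fin T → Fin K × ℝ) (i j : Fin p) :
    M.normalizedInfo θ ℓ ks reg k T x i j =
      (pulls k x : ℝ) / armRate ks reg k T ^ 2 * M.fisher θ ℓ k i j := by
  have : (∑ t, if (x t).1 = k then M.fisher θ ℓ k else 0) = (pulls k x : ℝ) • M.fisher θ ℓ k := by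
    rw [← Finset.sum_filter, Finset.sum_const, pulls, Nat.cast_smul_eq_nsmul]
  rw [normalizedInfo, this, Matrix.smul_apply, Matrix.smul_apply, smul_eq_mul, smul_eq_mul]
  ring

lemma SamplingAssumption.tendsto_normalizedInfo (h : M.SamplingAssumption pol θ ks C reg)
    (k : Fin K) (i j : Fin p) : TendstoInProbability (fun T => M.lawUpTo pol θ T)
      (fun T x => M.normalizedInfo θ ℓ ks reg k T x i j) (C k * M.fisher θ ℓ k i j) := by
  intro ε hε
  have hm : ∀ T, Measurable fun x : Fin T → Fin K × ℝ =>
      M.normalizedInfo θ ℓ ks reg k T x i j := fun T => by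
    simp_rw [normalizedInfo_apply]
    exact ((((measurable_of_countable (Nat.cast : ℕ → ℝ)).comp
      (measurable_pulls k)).div_const _).mul_const _)
  have hae : ∀ᵐ ω ∂(M.pathLaw pol θ), Tendsto
      (fun T => M.normalizedInfo θ ℓ ks reg k T (truncate T ω) i j) atTop
        (𝓝 (C k * M.fisher θ ℓ k i j)) := by
    filter_upwards [h.pullRate k] with ω hω
    simp_rw [normalizedInfo_apply]
    exact hω.mul_const _
  have := tendstoInMeasure_iff_norm.mp (tendstoInMeasure_of_tendsto_ae
    (fun T => ((hm T).comp (measurable_truncate T)).aestronglyMeasurable) hae) ε hε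
  refine this.congr fun T => ?_
  change _ = (M.pathLaw pol θ).map (truncate T) _
  rw [Measure.map_apply (measurable_truncate T)]
  · rfl
  · exact measurableSet_le measurable_const
      (continuous_abs.measurable.comp ((hm T).sub_const _))

/-! ### Localized parameters and the arm-wise likelihood expansion -/

lemma tendsto_toLp {ι : Type*} {l : Filter ι} {x : ι → Fin p → ℝ} {y : Fin p → ℝ}
    (h : ∀ j, Tendsto (fun i => x i j) l (𝓝 (y j))) :
    Tendsto (fun i => (WithLp.toLp 2 (x i) : Param p)) l (𝓝 (WithLp.toLp 2 y)) :=
  ((PiLp.continuous_toLp 2 _).tendsto y).comp (tendsto_pi_nhds.mpr h)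

/-- The vector `ω` with the coordinates in `s` replaced by zero. -/
def zeroOut (s : Finset (Fin p)) (ω : Param p) : Param p :=
  WithLp.toLp 2 fun j => if j ∈ s then 0 else ω j

lemma tendsto_zeroOut (s : Finset (Fin p)) : Tendsto (zeroOut s) (𝓝 0) (𝓝 0) := by
  have h : Tendsto (zeroOut s) (𝓝 0) (𝓝 (WithLp.toLp 2 fun _ => 0)) := by
    refine tendsto_toLp fun j => ?_
    split_ifs
    · exact tendsto_const_nhds
    · have : Continuous fun ω : Param p => ω j := by fun_prop
      simpa using this.tendsto 0
  exact h

/-- Local freeness allows changing one coordinate at a time, so the coordinates are removed by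
induction; the intermediate points stay in each neighbourhood because `zeroOut` is continuous at 0.
-/
lemma eventually_ae_eq_zeroOut {k : Fin K} (s : Finset (Fin p))
    (hs : ∀ j ∈ s, M.LocallyFreeOf k θ j) :
    ∀ᶠ ω in 𝓝 0, M.f k (θ + ω) =ᵐ[M.ν] M.f k (θ + zeroOut s ω) := by
  induction s using Finset.induction_on with
  | empty =>
    refine Eventually.of_forall fun ω => ?_
    have : zeroOut ∅ ω = ω := by
      ext j
      simp [zeroOut]
    rw [this]
  | insert j s hj ih =>
    obtain ⟨U, hU, hUf⟩ := hs j (Finset.mem_insert_self j s)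
    have hadd : Tendsto (fun ω : Param p => θ + ω) (𝓝 0) (𝓝 θ) := by
      have : Continuous fun ω : Param p => θ + ω := by fun_prop
      simpa using this.tendsto 0
    filter_upwards [ih fun i hi => hs i (Finset.mem_insert_of_mem hi),
      (hadd.comp (tendsto_zeroOut s)).eventually hU,
      (hadd.comp (tendsto_zeroOut (insert j s))).eventually hU] with ω h1 h2 h3
    refine h1.trans (hUf _ h2 _ h3 fun i hi => ?_)
    simp [zeroOut, hi]

/-- The deviation of the localized parameter from `θ`. -/
def localShift (M : ArmModel K p) (θ : Param p) (ℓ : Fin K → ℝ → Param p) (ks : Fin K)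
    (reg : Regime) (h : Param p) (T : ℕ) : Param p :=
  WithLp.toLp 2 fun j => (M.paramRate θ ℓ ks reg T j)⁻¹ * h j

lemma tendsto_paramRate (j : Fin p) :
    Tendsto (fun T => M.paramRate θ ℓ ks reg T j) atTop atTop := by
  unfold paramRate
  split_ifs
  · exact tendsto_sqrt_natCast
  · exact reg.tendsto_sqrt_size

lemma tendsto_localShift (h : Param p) : Tendsto (M.localShift θ ℓ ks reg h) atTop (𝓝 0) := by
  have : Tendsto (M.localShift θ ℓ ks reg h) atTop (𝓝 (WithLp.toLp 2 fun _ => 0)) := by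
    refine tendsto_toLp fun j => ?_
    simpa using (tendsto_inv_atTop_zero.comp (tendsto_paramRate j)).mul_const (h j)
  exact this

lemma tendsto_mul_inv_mul_self {ι : Type*} {l : Filter ι} {a : ι → ℝ} (ha : Tendsto a l atTop)
    (c : ℝ) : Tendsto (fun i => a i * ((a i)⁻¹ * c)) l (𝓝 c) := by
  refine tendsto_const_nhds.congr' ?_
  filter_upwards [ha.eventually_ne_atTop 0] with i hi
  rw [mul_inv_cancel_left₀ hi]

/-- The optimal arm in the logarithmic regime is excluded: there a component with zero information
is scaled by √T/√(log T), which diverges. -/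
lemma tendsto_smul_localShift (hks : M.IsDQM ks θ (ℓ ks)) {k : Fin K}
    (hk : reg = .linear ∨ k ≠ ks) (h : Param p) :
    Tendsto (fun T => armRate ks reg k T • M.localShift θ ℓ ks reg h T) atTop
      (𝓝 (M.maskedDir θ ℓ ks reg k h)) := by
  -- Reconciles the test 0 < J[j,j] in the rate with the test J[j,j] = 0 in the mask.
  have hnonneg : ∀ j, 0 ≤ M.fisher θ ℓ ks j j := fun j => (posSemidef_fisher hks).diag_nonneg
  refine tendsto_toLp fun j => ?_
  simp only [localShift]
  change Tendsto (fun T => armRate ks reg k T * ((M.paramRate θ ℓ ks reg T j)⁻¹ * h j)) _ _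
  cases reg with
  | linear =>
    have e : ∀ T, M.paramRate θ ℓ ks .linear T j = armRate ks .linear k T := fun T => by
      simp [paramRate, armRate, Regime.size]
    simp only [e, mask, one_mul]
    exact tendsto_mul_inv_mul_self (tendsto_armRate ks .linear k) (h j)
  | logarithmic =>
    have hk' : k ≠ ks := by simpa using hk
    simp only [mask, hk', false_or, armRate, if_false, paramRate, Regime.size]
    rcases (hnonneg j).eq_or_lt with hj | hj
    · simp only [← hj, lt_irrefl, if_false, if_true, one_mul]
      exact tendsto_mul_inv_mul_self (Regime.logarithmic).tendsto_sqrt_size (h j)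
    -- A component learned from the optimal arm moves at scale 1/√T, which is invisible to an arm
    -- with only order log T pulls.
    · simp only [hj, hj.ne', if_true, if_false, zero_mul]
      have := tendsto_sqrt_log_div_sqrt.mul_const (h j)
      rw [zero_mul] at this
      exact this.congr fun T => by rw [div_eq_mul_inv, mul_assoc]

/-- The expansion of the log-likelihood ratio of arm `k` along the localized parameters. -/
lemma tendsto_arm_logLikelihood (hθ : θ ∈ M.Θ) (hdqm : ∀ k, M.IsDQM k θ (ℓ k))
    (hfree : reg = .logarithmic →
      ∀ j, (∀ᵐ z ∂(M.law ks θ), ℓ ks z j = 0) → M.LocallyFreeOf ks θ j)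
    (h : Param p) (k : Fin K) (u : ℝ) :
    Tendsto (fun T => ((armRate ks reg k T ^ 2 : ℝ) : ℂ) * ((∫ z, Complex.exp
        ((u * (Real.log (M.f k (θ + M.localShift θ ℓ ks reg h T) z / M.f k θ z) -
          inner ℝ (ℓ k z) (M.maskedDir θ ℓ ks reg k h) / armRate ks reg k T) : ℝ) * Complex.I)
          ∂(M.law k θ)) - 1)) atTop
      (𝓝 ((-(u * (∫ z, (inner ℝ (ℓ k z) (M.maskedDir θ ℓ ks reg k h)) ^ 2 ∂(M.law k θ)) / 2) : ℝ)
        * Complex.I)) := by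
  by_cases hk : reg = .linear ∨ k ≠ ks
  · exact (hdqm k).tendsto_logLikelihood hθ (tendsto_armRate ks reg k)
      (tendsto_smul_localShift (hdqm ks) hk h) u
  -- The optimal arm in the logarithmic regime: the shift is replaced by its version without the
  -- components `s` of zero information. The density does not change ν-a.e. for large T, and the
  -- scaled shift now converges.
  · rw [not_or, not_not] at hk
    obtain ⟨hreg, rfl⟩ := hk
    obtain rfl : reg = .logarithmic := by cases reg <;> simp_all
    set s : Finset (Fin p) := Finset.univ.filter fun j => M.fisher θ ℓ k j j = 0 with hs
    have hω : Tendsto (fun T => armRate k .logarithmic k T •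
        zeroOut s (M.localShift θ ℓ k .logarithmic h T)) atTop (𝓝 (zeroOut s h)) := by
      refine tendsto_toLp fun j => ?_
      change Tendsto (fun T => armRate k .logarithmic k T *
        (if j ∈ s then 0 else (M.paramRate θ ℓ k .logarithmic T j)⁻¹ * h j)) _ _
      have hmem : j ∈ s ↔ M.fisher θ ℓ k j j = 0 := by simp [hs]
      by_cases hj : M.fisher θ ℓ k j j = 0
      · simp [hmem, hj]
      · have hpos : 0 < M.fisher θ ℓ k j j :=
          lt_of_le_of_ne (posSemidef_fisher (hdqm k)).diag_nonneg (Ne.symm hj)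
        simp only [hmem, hj, if_false, armRate, if_true, paramRate, hpos]
        exact tendsto_mul_inv_mul_self tendsto_sqrt_natCast (h j)
    have hfree' := (tendsto_localShift (M := M) (θ := θ) (ℓ := ℓ) (ks := k)
      (reg := .logarithmic) h).eventually (eventually_ae_eq_zeroOut (k := k) s fun j hj =>
        hfree rfl j (fisher_eq_zero (hdqm k) (by simpa [hs] using hj)))
    -- The mask of the optimal arm keeps all of h, but on `s` the score vanishes a.s., so both
    -- directions give the same linear term.
    have hinner : ∀ᵐ z ∂(M.law k θ), inner ℝ (ℓ k z) (M.maskedDir θ ℓ k .logarithmic k h) =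
        inner ℝ (ℓ k z) (zeroOut s h) := by
      have hall : ∀ᵐ z ∂(M.law k θ), ∀ j, M.fisher θ ℓ k j j = 0 → ℓ k z j = 0 :=
        ae_all_iff.mpr fun j => by
          by_cases hj : M.fisher θ ℓ k j j = 0
          · filter_upwards [fisher_eq_zero (hdqm k) hj] with z hz _ using hz
          · exact ae_of_all _ fun z hz => absurd hz hj
      filter_upwards [hall] with z hz
      rw [inner_eq_dotProduct, inner_eq_dotProduct]
      refine Finset.sum_congr rfl fun j _ => ?_
      by_cases hj : M.fisher θ ℓ k j j = 0
      · simp [hz j hj]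
      · simp [maskedDir, mask, zeroOut, hs, hj]
    have hlim := (hdqm k).tendsto_logLikelihood hθ (tendsto_armRate k .logarithmic k) hω u
    have e : ∫ z, (inner ℝ (ℓ k z) (M.maskedDir θ ℓ k .logarithmic k h)) ^ 2 ∂(M.law k θ) =
        ∫ z, (inner ℝ (ℓ k z) (zeroOut s h)) ^ 2 ∂(M.law k θ) :=
      integral_congr_ae (hinner.mono fun z hz => by simp only [hz])
    rw [e]
    refine hlim.congr' ?_
    filter_upwards [hfree'] with T hT
    have hac : M.law k θ ≪ M.ν := by
      rw [M.law_of_mem hθ]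
      exact withDensity_absolutelyContinuous _ _
    congr 2
    refine integral_congr_ae ?_
    filter_upwards [hac.ae_le hT, hinner] with z h1 h2
    rw [h1, h2]

/-! ### Limits of the scores and of the log-likelihood ratio -/

lemma measurable_scoreSum (hdqm : ∀ k, M.IsDQM k θ (ℓ k)) (k : Fin K) (T : ℕ) :
    Measurable (scoreSum ℓ ks reg k T) := by
  have h : Measurable fun x : Fin T → Fin K × ℝ =>
      ∑ t, if (x t).1 = k then ℓ k (x t).2 else 0 := by
    refine Finset.measurable_fun_sum _ fun t _ => Measurable.ite ?_ ?_ measurable_const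
    · exact (measurable_fst.comp (measurable_pi_apply t)) (measurableSet_singleton k)
    · exact (hdqm k).measurable.comp (measurable_snd.comp (measurable_pi_apply t))
  exact h.const_smul (armRate ks reg k T)⁻¹

lemma measurable_scoreSum_apply (hdqm : ∀ k, M.IsDQM k θ (ℓ k)) (k : Fin K) (T : ℕ) (j : Fin p) :
    Measurable fun x => scoreSum ℓ ks reg k T x j := by
  have h : Continuous fun v : Param p => v j := by fun_prop
  exact h.measurable.comp (measurable_scoreSum hdqm k T)

lemma measurable_stackedScore (hdqm : ∀ k, M.IsDQM k θ (ℓ k)) (T : ℕ) :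
    Measurable (stackedScore ℓ ks reg T) :=
  (WithLp.measurable_toLp 2 _).comp
    (measurable_pi_lambda _ fun jk => measurable_scoreSum_apply hdqm jk.2 T jk.1)

lemma measurable_centralSeq (hdqm : ∀ k, M.IsDQM k θ (ℓ k)) (T : ℕ) :
    Measurable (M.centralSeq θ ℓ ks reg T) := by
  cases reg with
  | linear =>
    exact (WithLp.measurable_toLp 2 _).comp (measurable_pi_lambda _ fun j =>
      Finset.measurable_fun_sum _ fun k _ => measurable_scoreSum_apply hdqm k T j)
  | logarithmic =>
    refine (WithLp.measurable_toLp 2 _).comp (measurable_pi_lambda _ fun j =>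
      (measurable_scoreSum_apply hdqm ks T j).add ?_)
    split_ifs
    · exact Finset.measurable_fun_sum _ fun k _ => measurable_scoreSum_apply hdqm k T j
    · exact measurable_const

/-- The characteristic function of the normalized scores in arm-dependent directions `v k`. -/
lemma tendsto_integral_exp_score (hθ : θ ∈ M.Θ) (hdqm : ∀ k, M.IsDQM k θ (ℓ k))
    (hsampling : M.SamplingAssumption pol θ ks C reg) (v : Fin K → Param p) :
    Tendsto (fun T => ∫ x, Complex.exp
      ((∑ t, inner ℝ (ℓ (x t).1 (x t).2) (v (x t).1) / armRate ks reg (x t).1 T : ℝ) * Complex.I)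
        ∂(M.lawUpTo pol θ T)) atTop
      (𝓝 (Complex.exp ((-((∑ k, C k * ∫ z, (inner ℝ (ℓ k z) (v k)) ^ 2 ∂(M.law k θ)) / 2) : ℝ) :
        ℂ))) := by
  have h := M.tendsto_integral_exp_sum pol θ
    (A := fun k T => armRate ks reg k T ^ 2)
    (fun k => (tendsto_pow_atTop two_ne_zero).comp (tendsto_armRate ks reg k))
    hsampling.nonneg hsampling.pullRate
    (g := fun k T y => inner ℝ (ℓ k y) (v k) / armRate ks reg k T)
    (fun k => Eventually.of_forall fun T => ((hdqm k).measurable_inner (v k)).div_const _)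
    (fun k => (hdqm k).tendsto_score hθ (tendsto_armRate ks reg k) (v k))
  have e : (∑ k, (C k : ℂ) *
      ((-((∫ z, (inner ℝ (ℓ k z) (v k)) ^ 2 ∂(M.law k θ)) / 2) : ℝ) : ℂ)) =
      ((-((∑ k, C k * ∫ z, (inner ℝ (ℓ k z) (v k)) ^ 2 ∂(M.law k θ)) / 2) : ℝ) : ℂ) := by
    rw [Finset.sum_div, ← Finset.sum_neg_distrib, Complex.ofReal_sum]
    refine Finset.sum_congr rfl fun k _ => ?_
    rw [← Complex.ofReal_mul]
    congr 1
    ring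
  rw [e] at h
  exact h

lemma tendstoInDistribution_stackedScore (hθ : θ ∈ M.Θ) (hdqm : ∀ k, M.IsDQM k θ (ℓ k))
    (hsampling : M.SamplingAssumption pol θ ks C reg) :
    TendstoInDistribution (fun T => stackedScore ℓ ks reg T) atTop id
      (fun T => M.lawUpTo pol θ T)
      (multivariateGaussian 0 (Matrix.blockDiagonal fun k => C k • M.fisher θ ℓ k)) := by
  refine tendstoInDistribution_multivariateGaussian
    (posSemidef_blockDiagonal hdqm hsampling.nonneg) (measurable_stackedScore hdqm) fun u => ?_
  simp_rw [inner_stackedScore]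
  rw [dotProduct_blockDiagonal_mulVec hdqm]
  exact tendsto_integral_exp_score hθ hdqm hsampling fun k => armPart k u

lemma tendstoInDistribution_centralSeq (hθ : θ ∈ M.Θ) (hdqm : ∀ k, M.IsDQM k θ (ℓ k))
    (hsampling : M.SamplingAssumption pol θ ks C reg) :
    TendstoInDistribution (fun T => M.centralSeq θ ℓ ks reg T) atTop id
      (fun T => M.lawUpTo pol θ T) (multivariateGaussian 0 (M.limitInfo θ ℓ ks C reg)) := by
  refine tendstoInDistribution_multivariateGaussian
    (posSemidef_limitInfo hdqm ks hsampling.apply_eq_one hsampling.nonneg)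
    (measurable_centralSeq hdqm) fun u => ?_
  simp_rw [inner_centralSeq]
  rw [dotProduct_limitInfo_mulVec hdqm ks hsampling.apply_eq_one]
  exact tendsto_integral_exp_score hθ hdqm hsampling fun k => M.maskedDir θ ℓ ks reg k u

/-- The score part of the log-likelihood ratio is h'Δ_T exactly, so the error is a sum of arm-wise
linearization errors plus q/2. Its characteristic function is handled by the same limit theorem as
the scores, without a separate law of large numbers. -/
lemma tendstoInProbability_llr (hθ : θ ∈ M.Θ) (hdqm : ∀ k, M.IsDQM k θ (ℓ k))
    (hfree : reg = .logarithmic →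
      ∀ j, (∀ᵐ z ∂(M.law ks θ), ℓ ks z j = 0) → M.LocallyFreeOf ks θ j)
    (hsampling : M.SamplingAssumption pol θ ks C reg) (h : Param p) :
    TendstoInProbability (fun T => M.lawUpTo pol θ T)
      (fun T x =>
        llr (M.lawUpTo pol (M.localParam θ ℓ ks reg T h) T) (M.lawUpTo pol θ T) x
          - (inner ℝ h (M.centralSeq θ ℓ ks reg T x)
            - (1 / 2) * (h.ofLp ⬝ᵥ (M.limitInfo θ ℓ ks C reg).mulVec h.ofLp))) 0 := by
  set q := h.ofLp ⬝ᵥ (M.limitInfo θ ℓ ks C reg).mulVec h.ofLp with hq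
  have hq' := dotProduct_limitInfo_mulVec hdqm ks hsampling.apply_eq_one h
  set g : Fin K → ℕ → ℝ → ℝ := fun k T z =>
    Real.log (M.f k (θ + M.localShift θ ℓ ks reg h T) z / M.f k θ z) -
      inner ℝ (ℓ k z) (M.maskedDir θ ℓ ks reg k h) / armRate ks reg k T with hg
  have hmem : ∀ᶠ T in atTop, θ + M.localShift θ ℓ ks reg h T ∈ M.Θ :=
    (tendsto_localShift h).eventually (eventually_add_mem hθ)
  have hgm : ∀ᶠ T in atTop, ∀ k, Measurable (g k T) := by
    filter_upwards [hmem] with T hT k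
    exact ((M.measurable_f k _ hT).div (M.measurable_f k θ hθ)).log.sub
      (((hdqm k).measurable_inner _).div_const _)
  have hae : ∀ᶠ T in atTop, (fun x =>
      llr (M.lawUpTo pol (M.localParam θ ℓ ks reg T h) T) (M.lawUpTo pol θ T) x
        - (inner ℝ h (M.centralSeq θ ℓ ks reg T x) - (1 / 2) * q)) =ᵐ[M.lawUpTo pol θ T]
      fun x => (∑ t, g (x t).1 T (x t).2) + q / 2 := by
    filter_upwards [hmem] with T hT
    filter_upwards [M.llr_lawUpTo hθ hT pol T] with x hx
    rw [show M.localParam θ ℓ ks reg T h = θ + M.localShift θ ℓ ks reg h T from rfl, hx,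
      real_inner_comm, inner_centralSeq, hg, Finset.sum_sub_distrib]
    ring
  refine tendstoInProbability_zero_of_tendsto_integral_exp ?_ fun u => ?_
  · filter_upwards [hae, hgm] with T hT hm
    exact ((measurable_sum_apply hm T).add_const _).aemeasurable.congr hT.symm
  · have hlim := (M.tendsto_integral_exp_sum pol θ (A := fun k T => armRate ks reg k T ^ 2)
      (fun k => (tendsto_pow_atTop two_ne_zero).comp (tendsto_armRate ks reg k))
      hsampling.nonneg hsampling.pullRate (g := fun k T z => u * g k T z)
      (fun k => hgm.mono fun T hT => (hT k).const_mul u)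
      (fun k => tendsto_arm_logLikelihood hθ hdqm hfree h k u)).mul_const
        (Complex.exp ((u * (q / 2) : ℝ) * Complex.I))
    -- The drift -iuq/2 collected over the arms cancels against the added constant q/2.
    have e : Complex.exp (∑ k, (C k : ℂ) * (((-(u * (∫ z, (inner ℝ (ℓ k z)
        (M.maskedDir θ ℓ ks reg k h)) ^ 2 ∂(M.law k θ)) / 2) : ℝ) : ℂ) * Complex.I)) *
        Complex.exp ((u * (q / 2) : ℝ) * Complex.I) = 1 := by
      rw [← Complex.exp_add, hq, hq', ← Complex.exp_zero]
      congr 1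
      push_cast
      rw [Finset.sum_div, Finset.mul_sum, Finset.sum_mul, ← Finset.sum_add_distrib]
      exact Finset.sum_eq_zero fun k _ => by ring
    rw [e] at hlim
    refine hlim.congr' ?_
    filter_upwards [hae] with T hT
    rw [← integral_mul_const]
    refine integral_congr_ae ?_
    filter_upwards [hT] with x hx
    rw [hx, ← Complex.exp_add, ← add_mul, ← Complex.ofReal_add, mul_add, Finset.mul_sum]

end ArmModel

end

end Bandit

theorem proposition2 {K p : ℕ} (M : Bandit.ArmModel K p) (pol : Bandit.Policy K)
    (θ : Bandit.Param p) (hθ : θ ∈ M.Θ)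
    (ℓ : Fin K → ℝ → Bandit.Param p) (ks : Fin K) (C : Fin K → ℝ) (reg : Bandit.Regime)
    (hdqm : ∀ k, M.IsDQM k θ (ℓ k))
    (hfree : reg = .logarithmic →
      ∀ j, (∀ᵐ z ∂(M.law ks θ), ℓ ks z j = 0) → M.LocallyFreeOf ks θ j)
    (hopt : M.IsUniqueOptimalArm θ ks)
    (hsampling : M.SamplingAssumption pol θ ks C reg) :
    (∀ k i j, Bandit.TendstoInProbability (fun T => M.lawUpTo pol θ T)
      (fun T x => M.normalizedInfo θ ℓ ks reg k T x i j) (C k * M.fisher θ ℓ k i j)) ∧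
    TendstoInDistribution (fun T => Bandit.stackedScore ℓ ks reg T) atTop id
      (fun T => M.lawUpTo pol θ T)
      (multivariateGaussian 0 (Matrix.blockDiagonal fun k => C k • M.fisher θ ℓ k)) ∧
    (∀ h : Bandit.Param p, Bandit.TendstoInProbability (fun T => M.lawUpTo pol θ T)
      (fun T x =>
        llr (M.lawUpTo pol (M.localParam θ ℓ ks reg T h) T) (M.lawUpTo pol θ T) x
          - (inner ℝ h (M.centralSeq θ ℓ ks reg T x)
            - (1 / 2) * (h.ofLp ⬝ᵥ (M.limitInfo θ ℓ ks C reg).mulVec h.ofLp))) 0) ∧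
    TendstoInDistribution (fun T => M.centralSeq θ ℓ ks reg T) atTop id
      (fun T => M.lawUpTo pol θ T)
      (multivariateGaussian 0 (M.limitInfo θ ℓ ks C reg)) := by
  exact ⟨fun k i j => hsampling.tendsto_normalizedInfo k i j,
    Bandit.ArmModel.tendstoInDistribution_stackedScore hθ hdqm hsampling,
    fun h => Bandit.ArmModel.tendstoInProbability_llr hθ hdqm hfree hsampling h,
    Bandit.ArmModel.tendstoInDistribution_centralSeq hθ hdqm hsampling⟩
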